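/- Let $\mathbb{Q}^N=\mathbb{Z}_2^N$ ($N\ge 1$) be the hypercube, $V=2^N$, and let $c_n^{(N)}$ be the number of $n$-step self-avoiding walks on $\mathbb{Q}^N$ started at $0$, i.e. injective maps $\omega:\{0,\dots,n\}\to\mathbb{Q}^N$ with $\omega(0)=0$ such that $\omega(i)$ and $\omega(i-1)$ differ in exactly one coordinate for $1\le i\le n$. The susceptibility is $\chi_N(z)=\sum_{n=0}^{V-1}c_n^{(N)}z^n$. For $\lambda>0$ with $\lambda V^{1/2}\ge 1$, the critical value $z_N=z_N(\lambda)$ is the unique $z_N\ge 0$ with $\chi_N(z_N)=\lambda V^{1/2}=\lambda 2^{N/2}$. For $z\ge 0$, the length $L$ is the random variable with $\mathbb{P}^{(N)}_z(L=n+1)=c_n^{(N)}z^n/\chi_N(z)$ for $n\ge 0$, and its expectation is $\mathbb{E}^{(N)}_zL=\sum_{n=0}^\infty (n+1)\,\mathbb{P}^{(N)}_z(L=n+1)$. **Theorem.** There are constants $\lambda_0>0$ and $C>0$ such that for every $\lambda\in(0,\lambda_0]$ and every integer $N\ge 1$ with $\lambda V^{1/2}\ge 1$, with $\beta=N^{-1}+\lambda^2$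 and $z_N=z_N(\lambda)$, the following hold. For all $z\in[0,z_N]$, $$[1-C\beta]\,\chi_N(z)\le \mathbb{E}^{(N)}_zL\le \chi_N(z).$$ In particular, at the critical value, $\mathbb{E}^{(N)}_{z_N}L=\lambda V^{1/2}[1+O(\beta)]$, that is, $$\bigl|\mathbb{E}^{(N)}_{z_N}L-\lambda V^{1/2}\bigr|\le C\beta\,\lambda V^{1/2}.$$ -/

import Mathlib

namespace HypercubeSAW

/-- The `N`-dimensional hypercube `ℤ₂^N`; `hammingNorm x` is the number of coordinates of `x`
equal to `1`. -/
abbrev Cube (N : ℕ) : Type := Fin N → ZMod 2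

/-- `ω(0), …, ω(n)` is an `n`-step self-avoiding walk on the hypercube, started at the origin. -/
structure IsSAW (N n : ℕ) (ω : Fin (n + 1) → Cube N) : Prop where
  start : ω 0 = 0
  step : ∀ i : Fin n, hammingNorm (ω i.succ - ω i.castSucc) = 1
  avoid : Function.Injective ω

/-- The number `c_n^{(N)}` of `n`-step self-avoiding walks on the hypercube started at `0`. -/
noncomputable def sawCount (N n : ℕ) : ℕ :=
  Nat.card {ω : Fin (n + 1) → Cube N // IsSAW N n ω}

/-- The susceptibility `χ_N(z) = ∑_{n < V} c_n^{(N)} z^n`, where `V = 2^N`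
(all later coefficients vanish, see `sawCount_eq_zero`). -/
noncomputable def susceptibility (N : ℕ) (z : ℝ) : ℝ :=
  ∑ n ∈ Finset.range (2 ^ N), (sawCount N n : ℝ) * z ^ n

/-- The critical value `z_N(lam)`: the nonnegative solution of `χ_N(z) = lam * V ^ (1/2)`.  For
`N ≥ 1` and `lam * V ^ (1/2) ≥ 1` it exists and is unique, see `criticalValue_spec` and
`eq_criticalValue`. -/
noncomputable def criticalValue (N : ℕ) (lam : ℝ) : ℝ :=
  Classical.epsilon fun z : ℝ => 0 ≤ z ∧ susceptibility N z = lam * √((2 : ℝ) ^ N)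

/-- The probability mass function of the length `L` (the number of vertices of the walk):
`lengthProb N z n` is `P_z(L = n + 1) = c_n^{(N)} z^n / χ_N(z)`. -/
noncomputable def lengthProb (N : ℕ) (z : ℝ) (n : ℕ) : ℝ :=
  (sawCount N n : ℝ) * z ^ n / susceptibility N z

/-- The expected length `E_z L = ∑_{n ≥ 0} (n + 1) P_z(L = n + 1)`; the sum has only finitely many
nonzero terms. -/
noncomputable def expectedLength (N : ℕ) (z : ℝ) : ℝ :=
  ∑' n : ℕ, ((n : ℝ) + 1) * lengthProb N z n

theorem sawCount_eq_zero {N n : ℕ} (h : 2 ^ N ≤ n) : sawCount N n = 0 := by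
  have : IsEmpty {ω : Fin (n + 1) → Cube N // IsSAW N n ω} := by
    refine ⟨fun ω => ?_⟩
    have := Fintype.card_le_of_injective _ ω.2.avoid
    simp [ZMod.card] at this
    omega
  simp [sawCount]

theorem sawCount_zero (N : ℕ) : sawCount N 0 = 1 := by
  rw [sawCount, Nat.card_eq_one_iff_unique]
  refine ⟨⟨fun a b => ?_⟩, ⟨⟨fun _ => 0, rfl, fun i => i.elim0, ?_⟩⟩⟩
  · ext i : 2
    have : i = 0 := Subsingleton.elim (α := Fin 1) i 0
    rw [this, a.2.start, b.2.start]
  · exact Function.injective_of_subsingleton (α := Fin 1) _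

theorem sawCount_one_pos {N : ℕ} (hN : 1 ≤ N) : 1 ≤ sawCount N 1 := by
  have : Nonempty {ω : Fin (1 + 1) → Cube N // IsSAW N 1 ω} := by
    have h1 : hammingNorm (Pi.single ⟨0, hN⟩ 1 : Cube N) = 1 := by
      rw [hammingNorm, Finset.card_eq_one]
      refine ⟨⟨0, hN⟩, ?_⟩
      ext i
      by_cases hi : i = ⟨0, hN⟩
      · subst hi; simp
      · simp [hi]
    have h0 : (Pi.single ⟨0, hN⟩ 1 : Cube N) ≠ 0 := by
      intro h
      rw [h] at h1
      simp at h1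
    refine ⟨⟨![0, Pi.single ⟨0, hN⟩ 1], rfl, ?_, ?_⟩⟩
    · intro i
      fin_cases i
      simpa using h1
    · intro i j hij
      fin_cases i <;> fin_cases j
      · rfl
      · exact absurd hij.symm h0
      · exact absurd hij h0
      · rfl
  exact Nat.one_le_iff_ne_zero.2 Nat.card_pos.ne'

theorem susceptibility_zero (N : ℕ) : susceptibility N 0 = 1 := by
  rw [susceptibility, Finset.sum_eq_single 0]
  · simp [sawCount_zero]
  · intro b _ hb; simp [hb]
  · simp

theorem susceptibility_strictMonoOn {N : ℕ} (hN : 1 ≤ N) :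
    StrictMonoOn (susceptibility N) (Set.Ici 0) := by
  intro x hx y hy hxy
  have hx : 0 ≤ x := hx
  refine Finset.sum_lt_sum (fun i _ => ?_) ⟨1, ?_, ?_⟩
  · gcongr
  · exact Finset.mem_range.2 (Nat.one_lt_two_pow (by omega))
  · have : (0 : ℝ) < sawCount N 1 := by exact_mod_cast sawCount_one_pos hN
    simpa using mul_lt_mul_of_pos_left hxy this

theorem one_le_susceptibility {N : ℕ} {z : ℝ} (hz : 0 ≤ z) : 1 ≤ susceptibility N z := by
  have h := Finset.single_le_sum (f := fun n => (sawCount N n : ℝ) * z ^ n)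
    (fun i _ => by positivity) (Finset.mem_range.2 (Nat.two_pow_pos N))
  simpa [susceptibility, sawCount_zero] using h

theorem le_susceptibility {N : ℕ} (hN : 1 ≤ N) {z : ℝ} (hz : 0 ≤ z) : z ≤ susceptibility N z := by
  have h := Finset.single_le_sum (f := fun n => (sawCount N n : ℝ) * z ^ n)
    (fun i _ => by positivity)
    (Finset.mem_range.2 (Nat.one_lt_two_pow (show N ≠ 0 by omega)))
  have h1 : (1 : ℝ) ≤ sawCount N 1 := by exact_mod_cast sawCount_one_pos hN
  have h2 : z ≤ sawCount N 1 * z := le_mul_of_one_le_left hz h1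
  exact h2.trans (by simpa [susceptibility] using h)

theorem criticalValue_spec {N : ℕ} (hN : 1 ≤ N) {lam : ℝ} (h : 1 ≤ lam * √((2 : ℝ) ^ N)) :
    0 ≤ criticalValue N lam ∧
      susceptibility N (criticalValue N lam) = lam * √((2 : ℝ) ^ N) := by
  refine Classical.epsilon_spec
    (p := fun z : ℝ => 0 ≤ z ∧ susceptibility N z = lam * √((2 : ℝ) ^ N)) ?_
  set a := lam * √((2 : ℝ) ^ N)
  have ha : (0 : ℝ) ≤ a := zero_le_one.trans h
  have hc : ContinuousOn (susceptibility N) (Set.Icc 0 a) := by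
    unfold susceptibility
    fun_prop
  obtain ⟨z, hz, hz'⟩ := intermediate_value_Icc ha hc
    ⟨by rwa [susceptibility_zero], le_susceptibility hN ha⟩
  exact ⟨z, hz.1, hz'⟩

theorem eq_criticalValue {N : ℕ} (hN : 1 ≤ N) {lam z : ℝ} (h : 1 ≤ lam * √((2 : ℝ) ^ N))
    (hz : 0 ≤ z) (hz' : susceptibility N z = lam * √((2 : ℝ) ^ N)) :
    z = criticalValue N lam :=
  (susceptibility_strictMonoOn hN).injOn hz (criticalValue_spec hN h).1
    (hz'.trans (criticalValue_spec hN h).2.symm)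

/-- For `z ≥ 0`, `lengthProb N z` is a probability mass function. -/
theorem lengthProb_nonneg_and_hasSum {N : ℕ} {z : ℝ} (hz : 0 ≤ z) :
    (∀ n, 0 ≤ lengthProb N z n) ∧ HasSum (lengthProb N z) 1 := by
  have hpos : 0 < susceptibility N z := zero_lt_one.trans_le (one_le_susceptibility hz)
  refine ⟨fun n => by unfold lengthProb; positivity, ?_⟩
  have h : ∑ n ∈ Finset.range (2 ^ N), lengthProb N z n = 1 := by
    simp only [lengthProb]
    rw [← Finset.sum_div]
    exact div_self hpos.ne'
  rw [← h]
  refine hasSum_sum_of_ne_finset_zero fun n hn => ?_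
  rw [Finset.mem_range, not_lt] at hn
  simp [lengthProb, sawCount_eq_zero hn]

end HypercubeSAW

/-! Write `χ` for the susceptibility and `G(x)` for the two-point function. The product `χ * E L` is
the generating function of walks with a marked vertex. Cutting at the mark gives an injection into
pairs of walks, hence `E L ≤ χ`. Conversely, a pair of walks from the origin either joins into one
walk marked at the junction, or meets at some `x ≠ 0`; pairs of the second kind weigh at most `χ²
∑_{x≠0} G(x)²`. So the theorem reduces to `∑_{x≠0} G(x)² = O(1/N + lam²)` (`susceptibility_sq_le`,
`NearCritical.sum_twoPoint_sq_le`).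

For the bubble, self-avoidance is relaxed to non-backtracking, whose Fourier transform is an
explicit polynomial in the eigenvalue. Walks shorter than `T = N²` contribute `O(1/N)` by Parseval
and concentration of the eigenvalues. In longer walks only the last `T` steps are relaxed.
Non-backtracking walk has mixed by then, up to parity, so these walks contribute `O(χ / V)` to every
`G(x)`, and the square summed over the `V` vertices is `O(lam²)` (`twoPoint_le`,
`NearCritical.pow_mul_nbCount_le`).

All this needs `(z(N-1))^T` bounded, that is `z(N-1) ≤ 1 + O(N⁻²)`. Comparison with simple random
walk would be too crude, since `(N/(N-1))^(N²)` is of order `exp N`. If `z` exceeded this threshold,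
monotonicity would give `χ ≤ √V` at the threshold `y`, where the estimates hold. There `G(e_d) ≤ y +
O(N⁻²)`, and counting walks by their first step gives a contradiction (`mul_susceptibility_le`,
`nearCritical_of_susceptibility_le`). Small `N` are absorbed into the constant. -/

namespace HypercubeSAW

/-! ### Self-avoiding walks as words of coordinate flips -/

variable {N : ℕ}

/-- The endpoint of the walk from the origin whose successive steps flip the coordinates listed
in `w`. -/
def disp (w : List (Fin N)) : Cube N := (w.map fun d => Pi.single d 1).sum

@[simp] theorem disp_nil : disp ([] : List (Fin N)) = 0 := by simp [disp]

@[simp] theorem disp_cons (d : Fin N) (w : List (Fin N)) :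
    disp (d :: w) = Pi.single d 1 + disp w := by simp [disp]

@[simp] theorem disp_append (u v : List (Fin N)) : disp (u ++ v) = disp u + disp v := by
  simp [disp]

@[simp] theorem disp_reverse (u : List (Fin N)) : disp u.reverse = disp u := by
  simp [disp, List.sum_reverse]

theorem cube_add_self (x : Cube N) : x + x = 0 := by
  ext i; exact CharTwo.add_self_eq_zero _

theorem cube_add_eq_zero {x y : Cube N} : x + y = 0 ↔ x = y := by
  constructor
  · intro h
    have := congrArg (· + y) h
    simpa [add_assoc, cube_add_self] using this
  · rintro rfl; exact cube_add_self x

/-- A word of directions is avoiding if its walk visits no vertex twice. -/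
def Avoiding (w : List (Fin N)) : Prop := ∀ u, u <:+: w → disp u = 0 → u = []

theorem Avoiding.infix {u w : List (Fin N)} (h : Avoiding w) (huw : u <:+: w) : Avoiding u :=
  fun v hv => h v (hv.trans huw)

theorem Avoiding.reverse {w : List (Fin N)} (h : Avoiding w) : Avoiding w.reverse := by
  intro u hu h0
  have := h u.reverse (by simpa using List.reverse_infix.2 hu) (by simpa using h0)
  simpa using this

theorem avoiding_nil : Avoiding ([] : List (Fin N)) := fun u hu _ => by simpa using hu

/-- A repeated letter undoes the preceding step. This is the only part of self-avoidance kept in the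
spectral estimates. -/
theorem Avoiding.isChain : ∀ {w : List (Fin N)}, Avoiding w → w.IsChain (· ≠ ·)
  | [], _ => List.IsChain.nil
  | [a], _ => List.IsChain.singleton a
  | a :: b :: l, h => by
    refine List.IsChain.cons_cons ?_ (Avoiding.isChain (h.infix (List.suffix_cons a _).isInfix))
    rintro rfl
    have := h [a, a] ⟨[], l, rfl⟩ (by simp [cube_add_self])
    simp at this

/-- The words of length `n`. -/
def words (N : ℕ) : ℕ → Finset (List (Fin N))
  | 0 => {[]}
  | n + 1 => (Finset.univ ×ˢ words N n).image fun p => p.1 :: p.2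

theorem mem_words {n : ℕ} : ∀ {w : List (Fin N)}, w ∈ words N n ↔ w.length = n := by
  induction n with
  | zero => simp [words]
  | succ n ih =>
    intro w
    cases w <;> simp [words, ih]

theorem sum_words_succ (n : ℕ) (f : List (Fin N) → ℝ) :
    ∑ w ∈ words N (n + 1), f w = ∑ d, ∑ w ∈ words N n, f (d :: w) := by
  rw [words, Finset.sum_image, Finset.sum_product]
  rintro ⟨a, b⟩ _ ⟨c, d⟩ _ h
  simpa using h

theorem hammingNorm_single (d : Fin N) : hammingNorm (Pi.single d 1 : Cube N) = 1 := by
  rw [hammingNorm, Finset.card_eq_one]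
  refine ⟨d, ?_⟩
  ext i
  by_cases hi : i = d
  · subst hi; simp
  · simp [hi]

theorem exists_eq_single {x : Cube N} (h : hammingNorm x = 1) : ∃ d, x = Pi.single d 1 := by
  rw [hammingNorm, Finset.card_eq_one] at h
  obtain ⟨d, hd⟩ := h
  refine ⟨d, ?_⟩
  ext i
  have hi := Finset.ext_iff.1 hd i
  by_cases hid : i = d
  · subst hid
    have h2 : ∀ a : ZMod 2, a ≠ 0 → a = 1 := by decide
    simpa using h2 _ (by simpa using hi)
  · simp only [Finset.mem_filter, Finset.mem_univ, true_and, Finset.mem_singleton, hid,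
      iff_false, not_not] at hi
    simp [hid, hi]

theorem single_injective : Function.Injective fun d : Fin N => (Pi.single d 1 : Cube N) := by
  intro a b h
  by_contra hab
  have := congrFun h a
  simp [hab] at this

theorem disp_take_succ (w : List (Fin N)) (i : ℕ) (hi : i < w.length) :
    disp (w.take (i + 1)) = disp (w.take i) + Pi.single w[i] 1 := by
  rw [List.take_succ_eq_append_getElem hi, disp_append, disp_cons, disp_nil, add_zero]

theorem isSAW_disp_take {w : List (Fin N)} {n : ℕ} (hn : w.length = n) (h : Avoiding w) :
    IsSAW N n fun i => disp (w.take i) where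
  start := by simp
  step i := by
    simp only [Fin.val_succ, Fin.val_castSucc]
    rw [disp_take_succ w i (by omega), add_sub_cancel_left, hammingNorm_single]
  avoid := by
    have key : ∀ i j : ℕ, i < j → j ≤ n → disp (w.take i) ≠ disp (w.take j) := by
      intro i j hij hj he
      have h1 : (w.take j) = w.take i ++ (w.take j).drop i := by
        conv_lhs => rw [← List.take_append_drop i (w.take j)]
        rw [List.take_take, min_eq_left hij.le]
      rw [h1, disp_append, left_eq_add] at he
      have h2 := h _ ((List.drop_suffix i _).isInfix.trans (List.take_prefix j w).isInfix) he
      have := congrArg List.length h2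
      simp at this
      omega
    intro i j he
    rcases lt_trichotomy (i : ℕ) j with hij | hij | hij
    · exact absurd he (key _ _ hij (by omega))
    · exact Fin.ext hij
    · exact absurd he.symm (key _ _ hij (by omega))

theorem avoiding_of_isSAW {n : ℕ} {ω : Fin (n + 1) → Cube N} (h : IsSAW N n ω)
    {w : List (Fin N)} (hn : w.length = n) (hw : ∀ i : Fin (n + 1), disp (w.take i) = ω i) :
    Avoiding w := by
  rintro u ⟨p, t, rfl⟩ hu
  have hl : p.length + u.length + t.length = n := by simpa [add_assoc] using hn
  have h1 := hw ⟨p.length, by omega⟩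
  have h2 := hw ⟨(p ++ u).length, by simp; omega⟩
  simp only [List.take_left] at h2
  rw [List.append_assoc, List.take_left] at h1
  have h3 : disp (p ++ u) = disp p := by simp [hu]
  have := congrArg Fin.val (h.avoid (h2.symm.trans (h3.trans h1)))
  simp only [List.length_append] at this
  exact List.eq_nil_of_length_eq_zero (by omega)

-- Each step of a walk on the cube flips a unique coordinate, so successive differences recover the
-- word from the walk.
open Classical in
theorem sawCount_eq_card (N n : ℕ) :
    sawCount N n = ((words N n).filter Avoiding).card := by
  rw [sawCount, ← Nat.card_eq_finsetCard]
  symm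
  have hm : ∀ w : ((words N n).filter Avoiding : Finset _), w.1.length = n ∧ Avoiding w.1 :=
    fun w => by
      have := w.2
      rwa [Finset.mem_filter, mem_words] at this
  refine Nat.card_eq_of_bijective
    (fun w => ⟨fun i => disp (w.1.take i), isSAW_disp_take (hm w).1 (hm w).2⟩) ⟨?_, ?_⟩
  · intro v w hvw
    have hf := congrFun (Subtype.ext_iff.1 hvw)
    refine Subtype.ext (List.ext_getElem ((hm v).1.trans (hm w).1.symm) fun i hv hw => ?_)
    have hi : i < n := (hm v).1 ▸ hv
    have h1 := hf ⟨i, by omega⟩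
    have h2 := hf ⟨i + 1, by omega⟩
    simp only at h1 h2
    rw [disp_take_succ _ _ hv, disp_take_succ _ _ hw, h1] at h2
    exact single_injective (add_left_cancel h2)
  · rintro ⟨ω, hω⟩
    choose d hd using fun i => exists_eq_single (hω.step i)
    have hlen : (List.ofFn d).length = n := by simp
    have key : ∀ i, (hi : i < n + 1) → disp ((List.ofFn d).take i) = ω ⟨i, hi⟩ := by
      intro i
      induction i with
      | zero => intro _; simpa using hω.start.symm
      | succ i ih =>
        intro hi
        rw [disp_take_succ _ _ (by simp; omega), ih (by omega)]
        have := hd ⟨i, by omega⟩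
        simp only [Fin.succ_mk, Fin.castSucc_mk] at this
        simp [← this]
    refine ⟨⟨List.ofFn d, ?_⟩, Subtype.ext (funext fun i => key i i.2)⟩
    simp only [Finset.mem_filter, mem_words, hlen, true_and]
    exact avoiding_of_isSAW hω hlen fun i => key i i.2

theorem Avoiding.length_lt {w : List (Fin N)} (h : Avoiding w) : w.length < 2 ^ N := by
  classical
  by_contra! hle
  have h0 := sawCount_eq_zero hle
  rw [sawCount_eq_card, Finset.card_eq_zero] at h0
  have : w ∈ (words N w.length).filter Avoiding := by simp [mem_words, h]
  simp [h0] at this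

open Classical in
/-- The finite set of all avoiding words. -/
noncomputable def avoidingWords (N : ℕ) : Finset (List (Fin N)) :=
  (Finset.range (2 ^ N)).biUnion fun n => (words N n).filter Avoiding

theorem mem_avoidingWords {w : List (Fin N)} : w ∈ avoidingWords N ↔ Avoiding w := by
  classical
  simp only [avoidingWords, Finset.mem_biUnion, Finset.mem_range, Finset.mem_filter, mem_words]
  exact ⟨fun ⟨_, _, _, h⟩ => h, fun h => ⟨_, h.length_lt, rfl, h⟩⟩

theorem sum_avoidingWords (f : ℕ → ℝ) :
    ∑ w ∈ avoidingWords N, f w.length = ∑ n ∈ Finset.range (2 ^ N), sawCount N n * f n := by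
  classical
  rw [avoidingWords, Finset.sum_biUnion]
  · refine Finset.sum_congr rfl fun n _ => ?_
    rw [sawCount_eq_card, ← nsmul_eq_mul, ← Finset.sum_const]
    refine Finset.sum_congr rfl fun w hw => ?_
    rw [Finset.mem_filter, mem_words] at hw
    rw [hw.1]
  · intro m _ n _ hmn
    refine Finset.disjoint_left.2 fun w hm hn => hmn ?_
    rw [Finset.mem_filter, mem_words] at hm hn
    exact hm.1.symm.trans hn.1

theorem susceptibility_eq_sum (N : ℕ) (z : ℝ) :
    susceptibility N z = ∑ w ∈ avoidingWords N, z ^ w.length :=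
  (sum_avoidingWords fun n => z ^ n).symm

theorem expectedLength_eq_sum (N : ℕ) (z : ℝ) :
    expectedLength N z =
      (∑ w ∈ avoidingWords N, ((w.length : ℝ) + 1) * z ^ w.length) / susceptibility N z := by
  rw [sum_avoidingWords fun n => ((n : ℝ) + 1) * z ^ n, Finset.sum_div, expectedLength,
    tsum_eq_sum (s := Finset.range (2 ^ N))]
  · refine Finset.sum_congr rfl fun n _ => ?_
    rw [lengthProb]; ring
  · intro n hn
    simp [lengthProb, sawCount_eq_zero (not_lt.1 (Finset.mem_range.not.1 hn))]

/-! ### Splitting and joining walks -/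

/-- The two-point function `G_z(x)`. -/
noncomputable def twoPoint (z : ℝ) (x : Cube N) : ℝ :=
  ∑ w ∈ avoidingWords N with disp w = x, z ^ w.length

open Classical in
/-- The total weight of the avoiding words that visit `x`. -/
noncomputable def visitWeight (z : ℝ) (x : Cube N) : ℝ :=
  ∑ w ∈ avoidingWords N with ∃ u, u <+: w ∧ disp u = x, z ^ w.length

theorem twoPoint_nonneg {z : ℝ} (hz : 0 ≤ z) (x : Cube N) : 0 ≤ twoPoint z x :=
  Finset.sum_nonneg fun _ _ => by positivity

theorem visitWeight_nonneg {z : ℝ} (hz : 0 ≤ z) (x : Cube N) : 0 ≤ visitWeight z x :=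
  Finset.sum_nonneg fun _ _ => by positivity

/-- The common form of the walk-counting inequalities: a weight-controlled injection between
families of walks. -/
theorem sum_le_sum_of_injOn {α β : Type*} [DecidableEq β] {s : Finset α} {t : Finset β}
    {f : α → ℝ} {g : β → ℝ} (e : α → β) (he : ∀ a ∈ s, e a ∈ t) (hinj : Set.InjOn e s)
    (hfg : ∀ a ∈ s, f a ≤ g (e a)) (hg : ∀ b ∈ t, 0 ≤ g b) :
    ∑ a ∈ s, f a ≤ ∑ b ∈ t, g b := by
  refine (Finset.sum_le_sum hfg).trans ?_
  rw [← Finset.sum_image hinj]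
  exact Finset.sum_le_sum_of_subset_of_nonneg (Finset.image_subset_iff.2 he) fun b hb _ => hg b hb

/-- Cutting the walk at its visit to `x` leaves a walk to `x` and, after translation, a walk from
the origin; concatenation recovers the original. -/
theorem visitWeight_le {z : ℝ} (hz : 0 ≤ z) (x : Cube N) :
    visitWeight z x ≤ twoPoint z x * susceptibility N z := by
  classical
  rw [visitWeight, twoPoint, susceptibility_eq_sum, Finset.sum_mul_sum, ← Finset.sum_product']
  have h : ∀ w : List (Fin N), ∃ p : List (Fin N) × List (Fin N),
      (∃ u, u <+: w ∧ disp u = x) → p.1 ++ p.2 = w ∧ disp p.1 = x := by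
    intro w
    by_cases hw : ∃ u, u <+: w ∧ disp u = x
    · obtain ⟨u, ⟨t, ht⟩, hu⟩ := hw
      exact ⟨(u, t), fun _ => ⟨ht, hu⟩⟩
    -- A default for words that do not visit `x`; it is never used.
    · exact ⟨([], []), fun h => absurd h hw⟩
  choose e he using h
  refine sum_le_sum_of_injOn e ?_ ?_ ?_ fun _ _ => by positivity
  · intro w hw
    simp only [Finset.mem_filter, mem_avoidingWords] at hw
    obtain ⟨h1, h2⟩ := he w hw.2
    simp only [Finset.mem_product, Finset.mem_filter, mem_avoidingWords]
    have hw1 := h1 ▸ hw.1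
    exact ⟨⟨hw1.infix (List.prefix_append _ _).isInfix, h2⟩,
      hw1.infix (List.suffix_append _ _).isInfix⟩
  · intro v hv w hw hvw
    simp only [Finset.coe_filter, Set.mem_ofPred_eq] at hv hw
    rw [← (he v hv.2).1, ← (he w hw.2).1, hvw]
  · intro w hw
    simp only [Finset.mem_filter] at hw
    obtain ⟨h1, -⟩ := he w hw.2
    conv_lhs => rw [← h1]
    rw [List.length_append, pow_add]

theorem sum_length_add_one_mul (z : ℝ) :
    ∑ w ∈ avoidingWords N, ((w.length : ℝ) + 1) * z ^ w.length =
      ∑ p ∈ (avoidingWords N).sigma fun w => Finset.range (w.length + 1), z ^ p.1.length := by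
  rw [Finset.sum_sigma]
  refine Finset.sum_congr rfl fun w _ => ?_
  simp

/-- Splitting a walk at any of its vertices gives a pair of walks. -/
theorem sum_length_le_susceptibility_sq {z : ℝ} (hz : 0 ≤ z) :
    ∑ w ∈ avoidingWords N, ((w.length : ℝ) + 1) * z ^ w.length ≤ susceptibility N z ^ 2 := by
  classical
  rw [sum_length_add_one_mul, sq, susceptibility_eq_sum, Finset.sum_mul_sum,
    ← Finset.sum_product']
  refine sum_le_sum_of_injOn (fun p => (p.1.take p.2, p.1.drop p.2)) ?_ ?_ ?_
    fun _ _ => by positivity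
  · rintro ⟨w, i⟩ hp
    simp only [Finset.mem_sigma, mem_avoidingWords] at hp
    simp only [Finset.mem_product, mem_avoidingWords]
    exact ⟨hp.1.infix (List.take_prefix _ _).isInfix, hp.1.infix (List.drop_suffix _ _).isInfix⟩
  · rintro ⟨v, i⟩ hv ⟨w, j⟩ hw h
    simp only [Finset.coe_sigma, Set.mem_sigma_iff, Finset.mem_coe, Finset.mem_range] at hv hw
    simp only [Prod.mk.injEq] at h
    obtain ⟨h1, h2⟩ := h
    have hvw : v = w := by rw [← List.take_append_drop i v, h1, h2, List.take_append_drop]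
    subst hvw
    have := congrArg List.length h1
    simp only [List.length_take] at this
    have hij : i = j := by omega
    rw [hij]
  · rintro ⟨w, i⟩ _
    rw [← pow_add, ← List.length_append, List.take_append_drop]

/-- A closed subword must straddle the junction, as each half is avoiding. Its two pieces, read
outward from the origin, then end at the same vertex. If that vertex were `0`, both pieces would be
empty. -/
theorem exists_common_vertex {v w : List (Fin N)} (hv : Avoiding v) (hw : Avoiding w)
    (h : ¬ Avoiding (v.reverse ++ w)) :
    ∃ x ≠ 0, (∃ u, u <+: v ∧ disp u = x) ∧ ∃ u, u <+: w ∧ disp u = x := by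
  simp only [Avoiding, not_forall] at h
  obtain ⟨u, hu, h0, hne⟩ := h
  rcases List.infix_append_iff.1 hu with h1 | h1 | ⟨a, b, rfl, ha, hb⟩
  · exact absurd (hv.reverse u h1 h0) hne
  · exact absurd (hw u h1 h0) hne
  rw [disp_append, cube_add_eq_zero] at h0
  have ha' : a.reverse <+: v := by simpa using List.reverse_prefix.2 ha
  refine ⟨disp a, fun hx => hne ?_, ⟨a.reverse, ha', by simp⟩, b, hb, h0.symm⟩
  have e1 := hv a.reverse ha'.isInfix (by simpa using hx)
  have e2 := hw b hb.isInfix (h0 ▸ hx)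
  simpa [e2] using e1

/-- Two walks either join to a longer walk or share a vertex besides the origin. -/
theorem susceptibility_sq_le {z : ℝ} (hz : 0 ≤ z) :
    susceptibility N z ^ 2 * (1 - ∑ x : Cube N with x ≠ 0, twoPoint z x ^ 2) ≤
      ∑ w ∈ avoidingWords N, ((w.length : ℝ) + 1) * z ^ w.length := by
  classical
  set χ := susceptibility N z with hχ
  set S := avoidingWords N with hS
  have h1 : χ ^ 2 = ∑ p ∈ S ×ˢ S, z ^ (p.1.length + p.2.length) := by
    rw [sq, hχ, susceptibility_eq_sum, Finset.sum_mul_sum, ← Finset.sum_product']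
    simp_rw [pow_add]
    rfl
  rw [← Finset.sum_filter_add_sum_filter_not _ fun p => Avoiding (p.1.reverse ++ p.2)] at h1
  have h2 : ∑ p ∈ S ×ˢ S with Avoiding (p.1.reverse ++ p.2), z ^ (p.1.length + p.2.length) ≤
      ∑ w ∈ avoidingWords N, ((w.length : ℝ) + 1) * z ^ w.length := by
    rw [sum_length_add_one_mul]
    -- The mark records the junction, so the pair can be recovered.
    refine sum_le_sum_of_injOn (fun p => ⟨p.1.reverse ++ p.2, p.1.length⟩) ?_ ?_ ?_
      fun _ _ => by positivity
    · rintro ⟨v, w⟩ hp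
      simp only [Finset.mem_filter] at hp
      simp only [Finset.mem_sigma, mem_avoidingWords, Finset.mem_range, List.length_append,
        List.length_reverse]
      exact ⟨hp.2, by omega⟩
    · rintro ⟨v, w⟩ _ ⟨v', w'⟩ _ h
      simp only [Sigma.mk.injEq, heq_eq_eq] at h
      have := List.append_inj h.1 (by simpa using h.2)
      simpa using this
    · rintro ⟨v, w⟩ _
      simp
  have h3 : ∑ p ∈ S ×ˢ S with ¬ Avoiding (p.1.reverse ++ p.2), z ^ (p.1.length + p.2.length) ≤
      ∑ x : Cube N with x ≠ 0, visitWeight z x ^ 2 := by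
    have h4 : ∀ x : Cube N, visitWeight z x ^ 2 =
        ∑ p ∈ S ×ˢ S with (∃ u, u <+: p.1 ∧ disp u = x) ∧ ∃ u, u <+: p.2 ∧ disp u = x,
          z ^ (p.1.length + p.2.length) := by
      intro x
      rw [sq, visitWeight, Finset.sum_mul_sum, ← Finset.sum_product', ← Finset.filter_product]
      simp_rw [pow_add]
      rfl
    simp_rw [h4]
    rw [Finset.sum_sigma']
    have hex : ∀ p : List (Fin N) × List (Fin N), ∃ x : Cube N,
        (p ∈ S ×ˢ S ∧ ¬ Avoiding (p.1.reverse ++ p.2)) →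
          x ≠ 0 ∧ (∃ u, u <+: p.1 ∧ disp u = x) ∧ ∃ u, u <+: p.2 ∧ disp u = x := by
      intro p
      by_cases hp : p ∈ S ×ˢ S ∧ ¬ Avoiding (p.1.reverse ++ p.2)
      · have hp1 := hp.1
        rw [Finset.mem_product, mem_avoidingWords, mem_avoidingWords] at hp1
        obtain ⟨x, hx⟩ := exists_common_vertex hp1.1 hp1.2 hp.2
        exact ⟨x, fun _ => hx⟩
      · exact ⟨0, fun h => absurd h hp⟩
    choose e he using hex
    refine sum_le_sum_of_injOn (fun p => ⟨e p, p⟩) ?_ ?_ (fun _ _ => le_rfl)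
      fun _ _ => by positivity
    · intro p hp
      rw [Finset.mem_filter] at hp
      have := he p hp
      simp only [Finset.mem_sigma, Finset.mem_filter, Finset.mem_univ, true_and]
      exact ⟨this.1, hp.1, this.2⟩
    · intro p _ q _ h
      simp only [Sigma.mk.injEq, heq_eq_eq] at h
      exact h.2
  have h5 : ∑ x : Cube N with x ≠ 0, visitWeight z x ^ 2 ≤
      χ ^ 2 * ∑ x : Cube N with x ≠ 0, twoPoint z x ^ 2 := by
    rw [Finset.mul_sum]
    refine Finset.sum_le_sum fun x _ => ?_
    rw [← mul_pow, mul_comm]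
    exact pow_le_pow_left₀ (visitWeight_nonneg hz x) (visitWeight_le hz x) 2
  linarith

/-- Prepending a step to a walk gives a walk unless the walk visits the new starting point. -/
theorem mul_susceptibility_le {z : ℝ} (hz : 0 ≤ z) :
    z * N * susceptibility N z ≤ susceptibility N z - 1 +
      z * ∑ d : Fin N, twoPoint z (Pi.single d 1) * susceptibility N z := by
  classical
  set S := avoidingWords N with hS
  have h1 : z * N * susceptibility N z = ∑ p ∈ (Finset.univ : Finset (Fin N)) ×ˢ S, z * z ^ p.2.length := by
    rw [Finset.sum_product]
    simp only [← Finset.mul_sum, Finset.sum_const, Finset.card_univ, Fintype.card_fin,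
      nsmul_eq_mul]
    rw [susceptibility_eq_sum]
    ring
  rw [← Finset.sum_filter_add_sum_filter_not _ fun p : Fin N × _ => Avoiding (p.1 :: p.2)] at h1
  have h2 : ∑ p ∈ (Finset.univ : Finset (Fin N)) ×ˢ S with Avoiding (p.1 :: p.2), z * z ^ p.2.length ≤
      susceptibility N z - 1 := by
    have h0 : susceptibility N z - 1 = ∑ w ∈ S.erase [], z ^ w.length := by
      rw [susceptibility_eq_sum,
        ← Finset.add_sum_erase _ _ (mem_avoidingWords.2 (avoiding_nil (N := N)))]
      simp [hS]
    rw [h0]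
    refine sum_le_sum_of_injOn (fun p => p.1 :: p.2) ?_ ?_ ?_ fun _ _ => by positivity
    · rintro p hp
      simp only [Finset.mem_filter] at hp
      simp [hS, mem_avoidingWords, hp.2]
    · rintro ⟨a, v⟩ _ ⟨b, w⟩ _ h
      simpa using h
    · intro p _
      simp [pow_succ']
  have h3 : ∑ p ∈ (Finset.univ : Finset (Fin N)) ×ˢ S with ¬ Avoiding (p.1 :: p.2), z * z ^ p.2.length ≤
      z * ∑ d : Fin N, visitWeight z (Pi.single d 1) := by
    rw [Finset.mul_sum, Finset.sum_filter, Finset.sum_product]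
    refine Finset.sum_le_sum fun d _ => ?_
    rw [visitWeight, Finset.mul_sum, ← Finset.sum_filter]
    refine Finset.sum_le_sum_of_subset_of_nonneg ?_ fun _ _ _ => by positivity
    intro w hw
    simp only [Finset.mem_filter, hS, mem_avoidingWords] at hw ⊢
    refine ⟨hw.1, ?_⟩
    have hd : Avoiding [d] := by
      intro u hu h0
      rcases List.infix_cons_iff.1 hu with h | h
      · rcases List.prefix_cons_iff.1 h with h | ⟨t, rfl, ht⟩
        · exact h
        · simp [List.prefix_nil.1 ht] at h0
      · simpa using h
    -- The one-step walk `[d]` has `e_d` as its only vertex besides the origin, so that is where `w`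
    -- meets it.
    obtain ⟨x, hx, ⟨u, hu, hux⟩, hw'⟩ := exists_common_vertex hd hw.1 (by simpa using hw.2)
    rcases List.prefix_cons_iff.1 hu with h | ⟨t, rfl, ht⟩
    · subst h; exact absurd hux.symm (by simpa using hx)
    · rw [List.prefix_nil.1 ht] at hux
      simpa [← hux] using hw'
  have h4 : z * ∑ d : Fin N, visitWeight z (Pi.single d 1) ≤
      z * ∑ d : Fin N, twoPoint z (Pi.single d 1) * susceptibility N z := by
    gcongr with d
    exact visitWeight_le hz _
  linarith

/-! ### Characters of the hypercube -/

/-- The nontrivial real character of `ℤ₂`. -/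
def sgn (c : ZMod 2) : ℝ := if c = 0 then 1 else -1

theorem sgn_add (a b : ZMod 2) : sgn (a + b) = sgn a * sgn b := by
  have h2 : ∀ c : ZMod 2, c = 0 ∨ c = 1 := by decide
  have h3 : (1 : ZMod 2) + 1 = 0 := by decide
  rcases h2 a with rfl | rfl <;> rcases h2 b with rfl | rfl <;> simp [sgn, h3]

theorem abs_sgn (a : ZMod 2) : |sgn a| = 1 := by
  unfold sgn; split_ifs <;> simp

theorem sum_zmod_two (f : ZMod 2 → ℝ) : ∑ c, f c = f 0 + f 1 := Fin.sum_univ_two f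

/-- The character of the hypercube with frequency `s`. -/
def character (s x : Cube N) : ℝ := ∏ i, sgn (s i * x i)

theorem character_add (s x y : Cube N) :
    character s (x + y) = character s x * character s y := by
  simp [character, mul_add, sgn_add, Finset.prod_mul_distrib]

@[simp] theorem character_zero_right (s : Cube N) : character s 0 = 1 := by
  simp [character, sgn]

@[simp] theorem character_zero_left (x : Cube N) : character 0 x = 1 := by
  simp [character, sgn]

theorem abs_character (s x : Cube N) : |character s x| = 1 := by
  simp [character, Finset.abs_prod, abs_sgn]

@[simp] theorem character_single (s : Cube N) (d : Fin N) :
    character s (Pi.single d 1) = sgn (s d) := by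
  rw [character, Finset.prod_eq_single d]
  · simp
  · intro i _ hi; simp [hi, sgn]
  · simp

theorem sum_prod_apply (f : Fin N → ZMod 2 → ℝ) :
    ∑ s : Cube N, ∏ i, f i (s i) = ∏ i, ∑ c, f i c := by
  rw [Finset.prod_univ_sum, Fintype.piFinset_univ]

theorem sum_character (x : Cube N) :
    ∑ s, character s x = if x = 0 then (2 : ℝ) ^ N else 0 := by
  simp only [character]
  rw [sum_prod_apply fun i c => sgn (c * x i)]
  split_ifs with h
  · subst h
    simp [sgn]
  · obtain ⟨i, hi⟩ := Function.ne_iff.1 h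
    refine Finset.prod_eq_zero (Finset.mem_univ i) ?_
    have : x i ≠ 0 := hi
    rw [sum_zmod_two]
    simp [sgn, this]

/-! ### Non-backtracking walks and their Fourier transform -/

/-- The number of words of length `n` from the origin to `x` without two equal consecutive
letters. -/
noncomputable def nbCount (n : ℕ) (x : Cube N) : ℝ :=
  ∑ w ∈ words N n, if w.IsChain (· ≠ ·) then (if disp w = x then 1 else 0) else 0

/-- The Fourier transform of `nbCount n`. -/
noncomputable def nbFourier (n : ℕ) (s : Cube N) : ℝ :=
  ∑ w ∈ words N n, if w.IsChain (· ≠ ·) then character s (disp w) else 0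

theorem nbCount_nonneg (n : ℕ) (x : Cube N) : 0 ≤ nbCount n x :=
  Finset.sum_nonneg fun w _ => by split_ifs <;> norm_num

theorem abs_nbFourier_le (n : ℕ) (s : Cube N) : |nbFourier n s| ≤ nbFourier n (0 : Cube N) := by
  refine (Finset.abs_sum_le_sum_abs _ _).trans (Finset.sum_le_sum fun w _ => ?_)
  split_ifs <;> simp [abs_character]

theorem nbCount_eq (n : ℕ) (x : Cube N) :
    nbCount n x = (2 ^ N : ℝ)⁻¹ * ∑ s, character s x * nbFourier n s := by
  have h2 : (2 ^ N : ℝ) ≠ 0 := by positivity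
  rw [eq_inv_mul_iff_mul_eq₀ h2, nbCount, Finset.mul_sum]
  simp only [nbFourier, Finset.mul_sum]
  rw [Finset.sum_comm]
  refine Finset.sum_congr rfl fun w _ => ?_
  split_ifs with h1 h3
  · rw [← h3]
    simp only [← character_add, cube_add_self]
    rw [sum_character]; simp
  · simp only [← character_add]
    rw [sum_character, if_neg fun h => h3 (cube_add_eq_zero.1 h).symm]; simp
  · simp

theorem sum_nbCount_mul_character (n : ℕ) (s : Cube N) :
    ∑ x, nbCount n x * character s x = nbFourier n s := by
  simp only [nbCount, nbFourier, Finset.sum_mul]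
  rw [Finset.sum_comm]
  refine Finset.sum_congr rfl fun w _ => ?_
  split_ifs with h1
  · simp
  · simp

/-- The Parseval identity for combinations of the counting functions `nbCount n`. -/
theorem sum_sq_sum_nbCount (I : Finset ℕ) (c : ℕ → ℝ) :
    ∑ x : Cube N, (∑ n ∈ I, c n * nbCount n x) ^ 2 =
      (2 ^ N : ℝ)⁻¹ * ∑ s : Cube N, (∑ n ∈ I, c n * nbFourier n s) ^ 2 := by
  have h1 : ∀ x : Cube N, ∑ n ∈ I, c n * nbCount n x =
      (2 ^ N : ℝ)⁻¹ * ∑ s, character s x * ∑ n ∈ I, c n * nbFourier n s := by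
    intro x
    simp only [Finset.mul_sum]
    rw [Finset.sum_comm]
    refine Finset.sum_congr rfl fun n _ => ?_
    rw [nbCount_eq, Finset.mul_sum, Finset.mul_sum]
    refine Finset.sum_congr rfl fun s _ => ?_
    ring
  have h2 : ∀ s : Cube N, ∑ n ∈ I, c n * nbFourier n s =
      ∑ x, (∑ n ∈ I, c n * nbCount n x) * character s x := by
    intro s
    simp only [Finset.sum_mul]
    rw [Finset.sum_comm]
    refine Finset.sum_congr rfl fun n _ => ?_
    rw [← sum_nbCount_mul_character, Finset.mul_sum]
    refine Finset.sum_congr rfl fun x _ => ?_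
    ring
  calc ∑ x : Cube N, (∑ n ∈ I, c n * nbCount n x) ^ 2
      = ∑ x : Cube N, (∑ n ∈ I, c n * nbCount n x) *
          ((2 ^ N : ℝ)⁻¹ * ∑ s, character s x * ∑ n ∈ I, c n * nbFourier n s) := by
        refine Finset.sum_congr rfl fun x _ => ?_
        rw [← h1, sq]
    _ = (2 ^ N : ℝ)⁻¹ * ∑ s : Cube N,
          (∑ x, (∑ n ∈ I, c n * nbCount n x) * character s x) *
            ∑ n ∈ I, c n * nbFourier n s := by
        simp_rw [Finset.mul_sum (Finset.univ : Finset (Cube N)), Finset.sum_mul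
          (Finset.univ : Finset (Cube N)), Finset.mul_sum (Finset.univ : Finset (Cube N))]
        rw [Finset.sum_comm]
        refine Finset.sum_congr rfl fun s _ => Finset.sum_congr rfl fun x _ => ?_
        ring
    _ = _ := by
        simp_rw [← h2, sq]

/-- The eigenvalue `N - 2|s|` of the adjacency operator of the hypercube at frequency `s`. -/
def eigenvalue (s : Cube N) : ℝ := ∑ d, sgn (s d)

/-- The polynomials of the non-backtracking walk on a regular graph of degree `N`. -/
def nbPoly (N a : ℝ) : ℕ → ℝ
  | 0 => 1
  | 1 => a
  | 2 => a ^ 2 - N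
  | n + 3 => a * nbPoly N a (n + 2) - (N - 1) * nbPoly N a (n + 1)

theorem nbFourier_zero (s : Cube N) : nbFourier 0 s = 1 := by
  simp [nbFourier, words]

/-- The part of `nbFourier` from words that may be continued backwards by the letter `d`. -/
noncomputable def nbFourierCons (n : ℕ) (s : Cube N) (d : Fin N) : ℝ :=
  ∑ w ∈ words N n, if (d :: w).IsChain (· ≠ ·) then character s (disp w) else 0

theorem nbFourier_succ (n : ℕ) (s : Cube N) :
    nbFourier (n + 1) s = ∑ d, sgn (s d) * nbFourierCons n s d := by
  rw [nbFourier, sum_words_succ]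
  refine Finset.sum_congr rfl fun d _ => ?_
  rw [nbFourierCons, Finset.mul_sum]
  refine Finset.sum_congr rfl fun w _ => ?_
  split_ifs <;> simp [character_add]

/-- Inclusion–exclusion: from all continuations, remove those starting with `d`. Summed over `d`,
this closes into the three-term recursion of `nbPoly`, where `N - 1` arises as `N` minus the
reinserted first letter. -/
theorem nbFourierCons_succ (n : ℕ) (s : Cube N) (d : Fin N) :
    nbFourierCons (n + 1) s d = nbFourier (n + 1) s - sgn (s d) * nbFourierCons n s d := by
  rw [nbFourier_succ, ← Finset.sum_erase_eq_sub (Finset.mem_univ d), nbFourierCons,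
    sum_words_succ, ← Finset.add_sum_erase _ _ (Finset.mem_univ d)]
  have h0 : ∀ w : List (Fin N), ¬ (d :: d :: w).IsChain (· ≠ ·) := by simp
  simp only [h0, if_false, Finset.sum_const_zero, zero_add]
  refine Finset.sum_congr rfl fun e he => ?_
  have hed : d ≠ e := (Finset.ne_of_mem_erase he).symm
  rw [nbFourierCons, Finset.mul_sum]
  refine Finset.sum_congr rfl fun w _ => ?_
  simp only [List.isChain_cons_cons, hed, ne_eq, not_false_eq_true, true_and]
  split_ifs <;> simp [character_add]

theorem nbFourier_add_two (n : ℕ) (s : Cube N) :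
    nbFourier (n + 2) s =
      eigenvalue s * nbFourier (n + 1) s - ∑ d, nbFourierCons n s d := by
  rw [nbFourier_succ, eigenvalue, Finset.sum_mul, ← Finset.sum_sub_distrib]
  refine Finset.sum_congr rfl fun d _ => ?_
  have h : sgn (s d) * sgn (s d) = 1 := by rw [← abs_mul_abs_self, abs_sgn, one_mul]
  rw [nbFourierCons_succ, mul_sub, ← mul_assoc, h, one_mul]

theorem nbFourier_eq (s : Cube N) : ∀ n, nbFourier n s = nbPoly N (eigenvalue s) n
  | 0 => nbFourier_zero s
  | 1 => by
    rw [nbFourier_succ, nbPoly, eigenvalue]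
    simp [nbFourierCons, words]
  | 2 => by
    rw [nbFourier_add_two, nbFourier_eq s 1, nbPoly, nbPoly]
    simp [nbFourierCons, words, sq]
  | n + 3 => by
    rw [nbFourier_add_two, nbPoly, nbFourier_eq s (n + 2)]
    simp only [nbFourierCons_succ]
    rw [Finset.sum_sub_distrib, ← nbFourier_succ, nbFourier_eq s (n + 1)]
    simp
    ring

theorem eigenvalue_zero : eigenvalue (0 : Cube N) = N := by
  simp [eigenvalue, sgn]

/-- The spectral gap. The frequencies `0` and `1` (the all-ones vector) are excluded: the latter is
the parity character, with eigenvalue `-N`. -/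
theorem abs_eigenvalue_le {s : Cube N} (h0 : s ≠ 0) (h1 : s ≠ 1) : |eigenvalue s| ≤ N - 2 := by
  have key : ∀ (g : Fin N → ℝ) (d : Fin N), g d = -1 → (∀ i, g i ≤ 1) →
      ∑ i, g i ≤ N - 2 := by
    intro g d hd hg
    have h := Finset.sum_le_sum (s := Finset.univ.erase d) fun i _ => hg i
    rw [Finset.sum_const, Finset.card_erase_of_mem (Finset.mem_univ d), Finset.card_univ,
      Fintype.card_fin, nsmul_eq_mul, mul_one,
      Nat.cast_pred (Fin.pos d)] at h
    rw [← Finset.add_sum_erase _ _ (Finset.mem_univ d), hd]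
    linarith
  have hab : ∀ i, |sgn (s i)| ≤ 1 := fun i => (abs_sgn _).le
  rw [abs_le', eigenvalue]
  constructor
  · obtain ⟨d, hd⟩ := Function.ne_iff.1 h0
    have hd : s d ≠ 0 := hd
    exact key _ d (by simp [sgn, hd]) fun i => (abs_le.1 (hab i)).2
  · obtain ⟨d, hd⟩ := Function.ne_iff.1 h1
    have h2 : ∀ a : ZMod 2, a ≠ 1 → a = 0 := by decide
    rw [← Finset.sum_neg_distrib]
    exact key _ d (by simp [sgn, h2 _ hd]) fun i => by linarith [(abs_le.1 (hab i)).1]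

/-- Under a uniform frequency the eigenvalue is a sum of `N` independent signs, so its exponential
moment factorizes. This is the source of all the moment and tail bounds. -/
theorem sum_exp_mul_eigenvalue (t : ℝ) :
    ∑ s : Cube N, Real.exp (t * eigenvalue s) = (2 * Real.cosh t) ^ N := by
  simp only [eigenvalue, Finset.mul_sum, Real.exp_sum]
  rw [sum_prod_apply fun _ c => Real.exp (t * sgn c)]
  simp only [sum_zmod_two, sgn, Finset.prod_const, Finset.card_univ, Fintype.card_fin]
  rw [Real.cosh_eq]
  simp
  ring_nf

theorem sum_cosh_mul_eigenvalue_le (t : ℝ) :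
    ∑ s : Cube N, Real.cosh (t * eigenvalue s) ≤ 2 ^ N * Real.exp (N * (t ^ 2 / 2)) := by
  have h : ∑ s : Cube N, Real.cosh (t * eigenvalue s) = (2 * Real.cosh t) ^ N := by
    have h1 := sum_exp_mul_eigenvalue (N := N) t
    have h2 := sum_exp_mul_eigenvalue (N := N) (-t)
    rw [Real.cosh_neg] at h2
    simp only [Real.cosh_eq, neg_mul] at *
    rw [← Finset.sum_div, Finset.sum_add_distrib, h1, h2]
    ring
  rw [h, mul_pow, Real.exp_nat_mul]
  gcongr
  exact Real.cosh_le_exp_half_sq t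

/-! ### Comparison with non-backtracking walks -/

/-- Walks are bounded by short non-backtracking walks plus a remainder that is uniform in the
endpoint. -/
theorem twoPoint_le {z τ : ℝ} (hz : 0 ≤ z) (T : ℕ) (x : Cube N)
    (hτ : ∀ y : Cube N, z ^ T * nbCount T y ≤ τ) :
    twoPoint z x ≤ ∑ n ∈ Finset.range T, z ^ n * nbCount n x + susceptibility N z * τ := by
  classical
  rw [twoPoint, ← Finset.sum_filter_add_sum_filter_not _ fun w => w.length < T]
  refine add_le_add ?_ ?_
  · have h : ∀ n, z ^ n * nbCount n x =
        ∑ w ∈ words N n with w.IsChain (· ≠ ·) ∧ disp w = x, z ^ w.length := by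
      intro n
      rw [nbCount, Finset.mul_sum, Finset.sum_filter]
      refine Finset.sum_congr rfl fun w hw => ?_
      rw [mem_words.1 hw]
      split_ifs <;> simp_all
    simp only [h]
    rw [Finset.sum_sigma']
    refine sum_le_sum_of_injOn (fun w => ⟨w.length, w⟩) ?_ ?_ (fun _ _ => le_rfl)
      fun _ _ => by positivity
    · intro w hw
      simp only [Finset.mem_filter, mem_avoidingWords] at hw
      simp only [Finset.mem_sigma, Finset.mem_range, Finset.mem_filter, mem_words, true_and]
      exact ⟨hw.2, hw.1.1.isChain, hw.1.2⟩
    · intro v _ w _ h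
      simp only [Sigma.mk.injEq, heq_eq_eq] at h
      exact h.2
  · have h1 : ∑ v ∈ avoidingWords N, z ^ v.length *
        (z ^ T * nbCount T (disp v + x)) ≤ susceptibility N z * τ := by
      rw [susceptibility_eq_sum, Finset.sum_mul]
      gcongr with v
      exact hτ _
    refine le_trans ?_ h1
    have h2 : ∀ v : List (Fin N), z ^ v.length * (z ^ T * nbCount T (disp v + x)) =
        ∑ w ∈ words N T with w.IsChain (· ≠ ·) ∧ disp w = disp v + x,
          z ^ (v.length + w.length) := by
      intro v
      rw [nbCount, Finset.mul_sum, Finset.mul_sum, Finset.sum_filter]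
      refine Finset.sum_congr rfl fun w hw => ?_
      rw [mem_words.1 hw, pow_add]
      split_ifs <;> simp_all
    simp only [h2]
    rw [Finset.sum_sigma']
    -- Only the last `T` steps are relaxed; the initial piece stays avoiding, so its total weight is
    -- `χ` rather than a divergent non-backtracking sum.
    refine sum_le_sum_of_injOn (fun w => ⟨w.take (w.length - T), w.drop (w.length - T)⟩)
      ?_ ?_ ?_ fun _ _ => by positivity
    · intro w hw
      simp only [Finset.mem_filter, mem_avoidingWords, not_lt] at hw
      simp only [Finset.mem_sigma, mem_avoidingWords, Finset.mem_filter, mem_words]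
      refine ⟨hw.1.1.infix (List.take_prefix _ _).isInfix, ?_,
        (hw.1.1.infix (List.drop_suffix _ _).isInfix).isChain, ?_⟩
      · rw [List.length_drop]; omega
      · have := hw.1.2
        rw [← List.take_append_drop (w.length - T) w, disp_append] at this
        rw [← this, ← add_assoc, cube_add_self, zero_add]
    · intro v _ w _ h
      simp only [Sigma.mk.injEq, heq_eq_eq] at h
      rw [← List.take_append_drop (v.length - T) v, h.1, h.2, List.take_append_drop]
    · intro w _
      rw [← List.length_append, List.take_append_drop]

theorem nbCount_zero {x : Cube N} (hx : x ≠ 0) : nbCount 0 x = 0 := by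
  simp [nbCount, words, hx.symm]

theorem nbCount_one_le (x : Cube N) : nbCount 1 x ≤ 1 := by
  rw [nbCount, sum_words_succ]
  simp only [words, Finset.sum_singleton, List.isChain_singleton, if_true, disp_cons, disp_nil,
    add_zero]
  rw [Finset.sum_boole]
  exact_mod_cast Finset.card_le_one.2 fun a ha b hb => by
    simp only [Finset.mem_filter, Finset.mem_univ, true_and] at ha hb
    exact single_injective (ha.trans hb.symm)

/-- Two distinct flips are determined by their sum up to order. -/
theorem nbCount_two_le (x : Cube N) : nbCount 2 x ≤ 2 := by
  classical
  rw [nbCount, sum_words_succ]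
  simp only [show ∀ f : List (Fin N) → ℝ, ∑ w ∈ words N 1, f w = _ from sum_words_succ 0]
  simp only [words, Finset.sum_singleton, List.isChain_singleton, List.isChain_cons_cons,
    disp_cons, disp_nil, add_zero, and_true, ← ite_and]
  rw [← Finset.sum_product', Finset.sum_boole]
  rcases Finset.eq_empty_or_nonempty ((Finset.univ ×ˢ Finset.univ).filter
    fun p : Fin N × Fin N => p.1 ≠ p.2 ∧ Pi.single p.1 1 + Pi.single p.2 1 = x) with h | ⟨p, hp⟩
  · rw [h]; simp
  have hsub : ((Finset.univ ×ˢ Finset.univ).filter fun p : Fin N × Fin N =>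
      p.1 ≠ p.2 ∧ Pi.single p.1 1 + Pi.single p.2 1 = x) ⊆ {p, p.swap} := by
    obtain ⟨a, b⟩ := p
    rintro ⟨c, d⟩ hcd
    simp only [Finset.mem_filter, Finset.mem_product, Finset.mem_univ, true_and] at hp hcd
    have he : (Pi.single a 1 + Pi.single b 1 : Cube N) = Pi.single c 1 + Pi.single d 1 :=
      hp.2.trans hcd.2.symm
    have ha := congrFun he a
    simp only [Finset.mem_insert, Finset.mem_singleton, Prod.swap_prod_mk, Prod.mk.injEq]
    by_cases hac : a = c
    · subst hac
      exact Or.inl ⟨rfl, (single_injective (add_left_cancel he)).symm⟩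
    · by_cases had : a = d
      · subst had
        rw [add_comm (Pi.single c 1)] at he
        exact Or.inr ⟨(single_injective (add_left_cancel he)).symm, rfl⟩
      · simp [hac, had, hp.1] at ha
  have := (Finset.card_le_card hsub).trans Finset.card_le_two
  exact_mod_cast this

theorem nbCount_succ_le (n : ℕ) {c : ℝ} (hc : ∀ y : Cube N, nbCount n y ≤ c) (x : Cube N) :
    nbCount (n + 1) x ≤ N * c := by
  rw [nbCount, sum_words_succ]
  have h : ∀ d : Fin N, ∑ w ∈ words N n, (if (d :: w).IsChain (· ≠ ·) then
      (if disp (d :: w) = x then (1 : ℝ) else 0) else 0) ≤ c := by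
    intro d
    refine le_trans (Finset.sum_le_sum fun w _ => ?_) (hc (Pi.single d 1 + x))
    by_cases h1 : (d :: w).IsChain (· ≠ ·)
    · rw [if_pos h1, if_pos (show w.IsChain (· ≠ ·) from List.IsChain.tail h1)]
      by_cases h2 : disp (d :: w) = x
      · rw [if_pos h2, if_pos]
        rw [← h2, disp_cons, ← add_assoc, cube_add_self, zero_add]
      · rw [if_neg h2]; split_ifs <;> norm_num
    · rw [if_neg h1]; split_ifs <;> norm_num
  refine (Finset.sum_le_sum fun d _ => h d).trans ?_
  simp

/-! ### Bounds on the non-backtracking polynomials -/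

theorem abs_nbPoly_le {N : ℝ} (hN : 1 ≤ N) (a : ℝ) : ∀ n, |nbPoly N a n| ≤ (|a| + √N) ^ n
  | 0 => by simp [nbPoly]
  | 1 => by simp [nbPoly]
  | 2 => by
    rw [nbPoly, abs_le]
    have h1 := Real.sq_sqrt (zero_le_one.trans hN)
    have h2 := mul_nonneg (abs_nonneg a) (Real.sqrt_nonneg N)
    constructor <;> nlinarith [sq_abs a, sq_nonneg a]
  | n + 3 => by
    have h1 := abs_nbPoly_le hN a (n + 2)
    have h2 := abs_nbPoly_le hN a (n + 1)
    set X := |a| + √N with hX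
    have hX0 : 0 ≤ X := by positivity
    have h3 : |a| * X + (N - 1) ≤ X ^ 2 := by
      nlinarith [Real.sq_sqrt (zero_le_one.trans hN),
        mul_nonneg (abs_nonneg a) (Real.sqrt_nonneg N)]
    calc |nbPoly N a (n + 3)|
        ≤ |a * nbPoly N a (n + 2)| + |(N - 1) * nbPoly N a (n + 1)| := abs_sub _ _
      _ = |a| * |nbPoly N a (n + 2)| + (N - 1) * |nbPoly N a (n + 1)| := by
        rw [abs_mul, abs_mul, abs_of_nonneg (sub_nonneg.2 hN)]
      _ ≤ |a| * X ^ (n + 2) + (N - 1) * X ^ (n + 1) := by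
        have := sub_nonneg.2 hN
        gcongr
      _ = X ^ (n + 1) * (|a| * X + (N - 1)) := by ring
      _ ≤ X ^ (n + 1) * X ^ 2 := by gcongr
      _ = X ^ (n + 3) := by ring

theorem nbPoly_self (N : ℝ) : ∀ n, nbPoly N N (n + 1) = N * (N - 1) ^ n
  | 0 => by simp [nbPoly]
  | 1 => by rw [nbPoly]; ring
  | n + 2 => by
    rw [nbPoly, nbPoly_self N (n + 1), nbPoly_self N n]
    ring

theorem nbPoly_neg (N a : ℝ) : ∀ n, nbPoly N (-a) n = (-1) ^ n * nbPoly N a n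
  | 0 => by simp [nbPoly]
  | 1 => by simp [nbPoly]
  | 2 => by simp [nbPoly]
  | n + 3 => by
    rw [nbPoly, nbPoly, nbPoly_neg N a (n + 2), nbPoly_neg N a (n + 1)]
    ring

/-- When `a ≥ 2√N` the recursion does not oscillate: the ratio of consecutive terms stays at least
`a / 2`, because `(N - 1) * (2 / a) ≤ a / 2`. -/
theorem nbPoly_pos {N a : ℝ} (hN : 1 ≤ N) (ha : 0 < a) (h : 4 * N ≤ a ^ 2) :
    ∀ n, 0 < nbPoly N a n ∧ a / 2 * nbPoly N a n ≤ nbPoly N a (n + 1)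
  | 0 => by simp [nbPoly]; linarith
  | 1 => by simp only [nbPoly]; exact ⟨ha, by nlinarith⟩
  | n + 2 => by
    obtain ⟨h1, h2⟩ := nbPoly_pos hN ha h (n + 1)
    have h3 : 0 < nbPoly N a (n + 2) := lt_of_lt_of_le (by positivity) h2
    refine ⟨h3, ?_⟩
    rw [nbPoly]
    have h4 : a / 2 * (a / 2 * nbPoly N a (n + 1)) ≤ a / 2 * nbPoly N a (n + 2) := by gcongr
    nlinarith

/-- In the non-oscillating range the subtracted term of the recursion is positive and may be
dropped. Unlike `abs_nbPoly_le`, this loses no `√N`, so the spectral gap survives after `N²` steps.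
-/
theorem abs_nbPoly_le_pow {N a : ℝ} (hN : 1 ≤ N) (h : 4 * N ≤ a ^ 2) (n : ℕ) :
    |nbPoly N a n| ≤ |a| ^ n := by
  have key : ∀ b : ℝ, 0 < b → 4 * N ≤ b ^ 2 → |nbPoly N b n| ≤ b ^ n := by
    intro b hb hb2
    rw [abs_of_pos (nbPoly_pos hN hb hb2 n).1]
    induction n with
    | zero => simp [nbPoly]
    | succ n ih =>
      have hstep : nbPoly N b (n + 1) ≤ b * nbPoly N b n := by
        match n with
        | 0 => simp [nbPoly]
        | 1 => simp only [nbPoly]; nlinarith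
        | m + 2 =>
          rw [nbPoly]
          have := (nbPoly_pos hN hb hb2 (m + 1)).1
          nlinarith
      rw [pow_succ']
      exact hstep.trans (by gcongr)
  rcases lt_trichotomy a 0 with ha | rfl | ha
  · have := key (-a) (by linarith) (by simpa using h)
    rw [nbPoly_neg, abs_mul, abs_pow, abs_neg, abs_one, one_pow, one_mul] at this
    rwa [abs_of_neg ha]
  · norm_num at h; linarith
  · rw [abs_of_pos ha]; exact key a ha h

/-! ### Spectral estimates near criticality -/

theorem one_add_sq_div_two_le_cosh (y : ℝ) : 1 + y ^ 2 / 2 ≤ Real.cosh y := by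
  have h1 : Real.cosh y = 1 + 2 * Real.sinh (y / 2) ^ 2 := by
    have := Real.cosh_two_mul (y / 2)
    rw [Real.cosh_sq, mul_div_cancel₀ y two_ne_zero] at this
    linarith
  have h2 : |y / 2| ≤ |Real.sinh (y / 2)| := by
    rw [Real.abs_sinh]
    exact Real.self_le_sinh_iff.2 (abs_nonneg _)
  have h3 := sq_le_sq.2 h2
  linarith [show (y / 2) ^ 2 = y ^ 2 / 4 by ring]

/-- The quadratic bound at `y / 2`, squared by the duplication formula. It turns second and fourth
moments into an exponential moment. -/
theorem one_add_pow_four_div_le_cosh (y : ℝ) : 1 + y ^ 2 / 2 + y ^ 4 / 32 ≤ Real.cosh y := by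
  have h1 := one_add_sq_div_two_le_cosh (y / 2)
  have h2 : Real.cosh y = 2 * Real.cosh (y / 2) ^ 2 - 1 := by
    have := Real.cosh_two_mul (y / 2)
    rw [Real.sinh_sq, mul_div_cancel₀ y two_ne_zero] at this
    linarith
  have h3 := pow_le_pow_left₀ (by positivity) h1 2
  linarith [show (1 + (y / 2) ^ 2 / 2) ^ 2 = 1 + y ^ 2 / 4 + y ^ 4 / 64 by ring]

/-- A rough bound, in units of `z`, on the Fourier transform of non-backtracking walks. -/
noncomputable def spectralRate (z : ℝ) (s : Cube N) : ℝ := z * (|eigenvalue s| + √N)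

theorem spectralRate_nonneg {z : ℝ} (hz : 0 ≤ z) (s : Cube N) : 0 ≤ spectralRate z s := by
  unfold spectralRate; positivity

theorem abs_pow_mul_nbFourier_le {z : ℝ} (hz : 0 ≤ z) (hN : 1 ≤ N) (n : ℕ) (s : Cube N) :
    |z ^ n * nbFourier n s| ≤ spectralRate z s ^ n := by
  rw [abs_mul, abs_of_nonneg (pow_nonneg hz n), spectralRate, mul_pow, nbFourier_eq]
  gcongr
  exact abs_nbPoly_le (by exact_mod_cast hN) _ n

/-- The condition that `z` is at most slightly above `1 / (N - 1)`, in large dimension. -/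
structure NearCritical (N : ℕ) (K z : ℝ) : Prop where
  nonneg : 0 ≤ z
  dim : 100 ≤ N
  pos : 0 ≤ K
  small : 10 * K ≤ (N : ℝ) ^ 2
  le : z * (N - 1) ≤ 1 + K / (N : ℝ) ^ 2

namespace NearCritical

variable {K z : ℝ}

theorem dim' (h : NearCritical N K z) : (100 : ℝ) ≤ N := by exact_mod_cast h.dim

theorem mul_le (h : NearCritical N K z) : z * N ≤ 5 / 4 := by
  have h1 := h.le
  have h2 := h.dim'
  have h3 : K / (N : ℝ) ^ 2 ≤ 1 / 10 := by
    rw [div_le_div_iff₀ (by positivity) (by norm_num)]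
    linarith [h.small]
  nlinarith [h.nonneg]

theorem pow_le (h : NearCritical N K z) {n : ℕ} (hn : n ≤ N ^ 2) :
    (z * (N - 1)) ^ n ≤ Real.exp K := by
  have h2 := h.dim'
  have h0 : 0 ≤ z * (N - 1) := mul_nonneg h.nonneg (by linarith)
  have h3 : 0 ≤ K / (N : ℝ) ^ 2 := div_nonneg h.pos (by positivity)
  calc (z * (N - 1)) ^ n ≤ (Real.exp (K / (N : ℝ) ^ 2)) ^ n := by
        gcongr
        linarith [h.le, Real.add_one_le_exp (K / (N : ℝ) ^ 2)]
    _ ≤ (Real.exp (K / (N : ℝ) ^ 2)) ^ (N ^ 2) :=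
        pow_le_pow_right₀ (Real.one_le_exp h3) hn
    _ = Real.exp K := by
        rw [← Real.exp_nat_mul]
        congr 1
        push_cast
        field_simp

theorem abs_le_exp (h : NearCritical N K z) {n : ℕ} (hn : n ≤ N ^ 2) (s : Cube N) :
    |z ^ n * nbFourier n s| ≤ 2 * Real.exp K := by
  have h1 := Real.one_le_exp h.pos
  rw [abs_mul, abs_of_nonneg (pow_nonneg h.nonneg n)]
  refine (mul_le_mul_of_nonneg_left (abs_nbFourier_le n s) (pow_nonneg h.nonneg n)).trans ?_
  cases n with
  | zero => rw [nbFourier_zero]; linarith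
  | succ n =>
    rw [nbFourier_eq, eigenvalue_zero, nbPoly_self]
    have h2 := h.pow_le (n := n) (by omega)
    calc z ^ (n + 1) * (N * (N - 1 : ℝ) ^ n) = z * N * (z * (N - 1)) ^ n := by
          rw [mul_pow]; ring
      _ ≤ 5 / 4 * Real.exp K := mul_le_mul h.mul_le h2
          (pow_nonneg (mul_nonneg h.nonneg (by linarith [h.dim'])) _) (by norm_num)
      _ ≤ 2 * Real.exp K := by linarith

theorem half_lt_abs_eigenvalue (h : NearCritical N K z) {s : Cube N}
    (hs : 3 / 4 < spectralRate z s) : (N : ℝ) / 2 < |eigenvalue s| := by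
  by_contra! hle
  have h2 := h.dim'
  have h3 : √(N : ℝ) ≤ N / 10 := by
    rw [Real.sqrt_le_left (by positivity)]
    nlinarith
  -- The threshold is `3/4 = 5/4 * (1/2 + 1/10)`.
  have h4 : spectralRate z s ≤ z * (N / 2 + N / 10) := by
    unfold spectralRate
    have := h.nonneg
    gcongr
  linarith [h.mul_le]

theorem spectralRate_le (h : NearCritical N K z) (s : Cube N) :
    spectralRate z s ≤ 5 / 4 * ((√N)⁻¹ * (|(√N)⁻¹ * eigenvalue s| + 1)) := by
  have h2 := h.dim'
  have h3 : 0 < √(N : ℝ) := Real.sqrt_pos.2 (by linarith)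
  have h4 : |eigenvalue s| + √N = N * ((√N)⁻¹ * (|(√N)⁻¹ * eigenvalue s| + 1)) := by
    rw [abs_mul, abs_of_pos (inv_pos.2 h3)]
    nth_rw 2 [← Real.mul_self_sqrt (Nat.cast_nonneg N)]
    field_simp
  rw [spectralRate, h4, ← mul_assoc]
  gcongr
  exact h.mul_le

theorem sum_cosh_le (h : NearCritical N K z) :
    ∑ s : Cube N, Real.cosh ((√N)⁻¹ * eigenvalue s) ≤ 2 ^ N * 2 := by
  refine (sum_cosh_mul_eigenvalue_le _).trans ?_
  have h2 := h.dim'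
  gcongr
  rw [inv_pow, Real.sq_sqrt (by positivity)]
  have : (N : ℝ) * ((N : ℝ)⁻¹ / 2) = 1 / 2 := by field_simp
  rw [this]
  have h3 := Real.exp_one_lt_d9
  have h4 : Real.exp 1 = Real.exp (1 / 2) ^ 2 := by
    rw [← Real.exp_nat_mul]; norm_num
  nlinarith [Real.exp_pos (1 / 2)]

theorem sum_sq_le (h : NearCritical N K z) :
    ∑ s : Cube N, spectralRate z s ^ 2 ≤ 2 ^ N * (20 / N) := by
  have h2 := h.dim'
  have key : ∀ s : Cube N, spectralRate z s ^ 2 ≤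
      10 / N * Real.cosh ((√N)⁻¹ * eigenvalue s) := by
    intro s
    have h1 := one_add_pow_four_div_le_cosh ((√N)⁻¹ * eigenvalue s)
    have h3 := pow_le_pow_left₀ (spectralRate_nonneg h.nonneg s) (h.spectralRate_le s) 2
    refine h3.trans ?_
    set y := (√N)⁻¹ * eigenvalue s
    have h4 : 25 / 16 * (|y| + 1) ^ 2 ≤ 10 * Real.cosh y := by
      nlinarith [sq_abs y, sq_nonneg (|y| - 1), sq_nonneg (y ^ 2)]
    calc _ = (N : ℝ)⁻¹ * (25 / 16 * (|y| + 1) ^ 2) := by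
          rw [mul_pow, mul_pow, inv_pow, Real.sq_sqrt (by positivity)]; ring
      _ ≤ (N : ℝ)⁻¹ * (10 * Real.cosh y) := by gcongr
      _ = _ := by ring
  refine (Finset.sum_le_sum fun s _ => key s).trans ?_
  rw [← Finset.mul_sum]
  refine (mul_le_mul_of_nonneg_left h.sum_cosh_le (by positivity)).trans (le_of_eq ?_)
  ring

/-- Typical eigenvalues are of order `√N`, so the rate is typically of order `N^(-1/2)`, with
Gaussian-type moments. -/
theorem sum_pow_four_le (h : NearCritical N K z) :
    ∑ s : Cube N, spectralRate z s ^ 4 ≤ 2 ^ N * (1300 / N ^ 2) := by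
  have h2 := h.dim'
  have key : ∀ s : Cube N, spectralRate z s ^ 4 ≤
      650 / N ^ 2 * Real.cosh ((√N)⁻¹ * eigenvalue s) := by
    intro s
    have h1 := one_add_pow_four_div_le_cosh ((√N)⁻¹ * eigenvalue s)
    have h3 := pow_le_pow_left₀ (spectralRate_nonneg h.nonneg s) (h.spectralRate_le s) 4
    refine h3.trans ?_
    set y := (√N)⁻¹ * eigenvalue s
    have h4 : ((√N)⁻¹) ^ 4 = ((N : ℝ) ^ 2)⁻¹ := by
      rw [inv_pow, show 4 = 2 * 2 by norm_num, pow_mul, Real.sq_sqrt (by positivity)]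
    have h5 : (|y| + 1) ^ 4 ≤ 8 * (y ^ 4 + 1) := by
      have h6 : (|y| + 1) ^ 2 ≤ 2 * (y ^ 2 + 1) := by
        nlinarith [sq_abs y, sq_nonneg (|y| - 1)]
      have h7 := pow_le_pow_left₀ (by positivity) h6 2
      nlinarith [sq_nonneg (y ^ 2 - 1)]
    calc _ = ((N : ℝ) ^ 2)⁻¹ * (625 / 256 * (|y| + 1) ^ 4) := by
          rw [mul_pow, mul_pow, h4]; ring
      _ ≤ ((N : ℝ) ^ 2)⁻¹ * (650 * Real.cosh y) := by
          refine mul_le_mul_of_nonneg_left ?_ (by positivity)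
          linarith [sq_nonneg y, Real.cosh_pos y]
      _ = _ := by ring
  refine (Finset.sum_le_sum fun s _ => key s).trans ?_
  rw [← Finset.mul_sum]
  refine (mul_le_mul_of_nonneg_left h.sum_cosh_le (by positivity)).trans (le_of_eq ?_)
  ring

end NearCritical

/-- The indicator function of the frequencies with a large eigenvalue. -/
noncomputable def largeIndicator (s : Cube N) : ℝ :=
  if (N : ℝ) / 2 < |eigenvalue s| then 1 else 0

/-- Chernoff's bound with parameter `1/2`: the factor `exp (-N/4)` from the threshold beats the
moment `exp (N/8)`. -/
theorem sum_largeIndicator_le (N : ℕ) :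
    ∑ s : Cube N, largeIndicator s ≤ 2 ^ N * (2 * Real.exp (-N / 8)) := by
  have key : ∀ s : Cube N, largeIndicator s ≤
      2 * Real.exp (-N / 4) * Real.cosh (1 / 2 * eigenvalue s) := by
    intro s
    have hc := Real.cosh_pos (1 / 2 * eigenvalue s)
    unfold largeIndicator
    split_ifs with hs
    · have h1 : Real.exp (N / 4) ≤ 2 * Real.cosh (1 / 2 * eigenvalue s) := by
        rw [← Real.cosh_abs, Real.cosh_eq, abs_mul, abs_of_pos (by norm_num : (0 : ℝ) < 1 / 2)]
        have := Real.exp_pos (-(1 / 2 * |eigenvalue s|))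
        have h2 : Real.exp (N / 4) ≤ Real.exp (1 / 2 * |eigenvalue s|) :=
          Real.exp_le_exp.2 (by linarith)
        linarith
      calc (1 : ℝ) = Real.exp (-N / 4) * Real.exp (N / 4) := by
            rw [← Real.exp_add]; ring_nf; simp
        _ ≤ Real.exp (-N / 4) * (2 * Real.cosh (1 / 2 * eigenvalue s)) := by gcongr
        _ = _ := by ring
    · positivity
  refine (Finset.sum_le_sum fun s _ => key s).trans ?_
  rw [← Finset.mul_sum]
  refine (mul_le_mul_of_nonneg_left (sum_cosh_mul_eigenvalue_le _) (by positivity)).trans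
    (le_of_eq ?_)
  have : Real.exp (-N / 8) = Real.exp (-N / 4) * Real.exp (N * ((1 / 2) ^ 2 / 2)) := by
    rw [← Real.exp_add]; ring_nf
  rw [this]
  ring

namespace NearCritical

variable {K z : ℝ}

/-- At most frequencies the sum is geometric with ratio at most `3/4`. The others have a large
eigenvalue and are exponentially rare, so bounding each of their at most `N²` terms crudely is
affordable. -/
theorem sum_Ico_le (h : NearCritical N K z) (j : ℕ) (s : Cube N) :
    ∑ n ∈ Finset.Ico j (N ^ 2), |z ^ n * nbFourier n s| ≤
      4 * spectralRate z s ^ j + N ^ 2 * (2 * Real.exp K) * largeIndicator s := by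
  have hr := spectralRate_nonneg h.nonneg s
  by_cases hs : spectralRate z s ≤ 3 / 4
  · have h1 : ∑ n ∈ Finset.Ico j (N ^ 2), |z ^ n * nbFourier n s| ≤
        ∑ n ∈ Finset.Ico j (N ^ 2), spectralRate z s ^ n :=
      Finset.sum_le_sum fun n _ =>
        abs_pow_mul_nbFourier_le h.nonneg (by linarith [h.dim]) n s
    have h2 : spectralRate z s ^ j / (1 - spectralRate z s) ≤ 4 * spectralRate z s ^ j := by
      rw [div_le_iff₀ (by linarith)]
      nlinarith [pow_nonneg hr j]
    have h3 : 0 ≤ largeIndicator s := by unfold largeIndicator; split_ifs <;> norm_num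
    have h4 : 0 ≤ N ^ 2 * (2 * Real.exp K) * largeIndicator s := by positivity
    linarith [geom_sum_Ico_le_of_lt_one (m := j) (n := N ^ 2) hr (by linarith)]
  · push Not at hs
    rw [largeIndicator, if_pos (h.half_lt_abs_eigenvalue hs), mul_one]
    have h1 : ∑ n ∈ Finset.Ico j (N ^ 2), |z ^ n * nbFourier n s| ≤
        ∑ n ∈ Finset.Ico j (N ^ 2), 2 * Real.exp K :=
      Finset.sum_le_sum fun n hn => h.abs_le_exp (Finset.mem_Ico.1 hn).2.le s
    rw [Finset.sum_const, Nat.card_Ico, nsmul_eq_mul] at h1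
    have h2 : ((N ^ 2 - j : ℕ) : ℝ) ≤ (N : ℝ) ^ 2 := by
      exact_mod_cast Nat.sub_le _ _
    have h3 : ((N ^ 2 - j : ℕ) : ℝ) * (2 * Real.exp K) ≤ (N : ℝ) ^ 2 * (2 * Real.exp K) := by
      gcongr
    have := pow_nonneg hr j
    linarith

theorem sum_pow_mul_nbCount_le (h : NearCritical N K z) (x : Cube N) :
    ∑ n ∈ Finset.Ico 4 (N ^ 2), z ^ n * nbCount n x ≤
      5200 / N ^ 2 + N ^ 2 * (2 * Real.exp K) * (2 * Real.exp (-N / 8)) := by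
  have h1 : ∑ n ∈ Finset.Ico 4 (N ^ 2), z ^ n * nbCount n x =
      (2 ^ N : ℝ)⁻¹ * ∑ s : Cube N, ∑ n ∈ Finset.Ico 4 (N ^ 2),
        character s x * (z ^ n * nbFourier n s) := by
    rw [Finset.sum_comm, Finset.mul_sum]
    refine Finset.sum_congr rfl fun n _ => ?_
    rw [nbCount_eq, Finset.mul_sum, Finset.mul_sum, Finset.mul_sum]
    exact Finset.sum_congr rfl fun s _ => by ring
  rw [h1, inv_mul_le_iff₀ (by positivity)]
  have h2 : ∀ s : Cube N, ∑ n ∈ Finset.Ico 4 (N ^ 2), character s x * (z ^ n * nbFourier n s) ≤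
      4 * spectralRate z s ^ 4 + N ^ 2 * (2 * Real.exp K) * largeIndicator s := by
    intro s
    refine (Finset.sum_le_sum fun n _ => ?_).trans (h.sum_Ico_le 4 s)
    refine (le_abs_self _).trans ?_
    rw [abs_mul, abs_character, one_mul]
  refine (Finset.sum_le_sum fun s _ => h2 s).trans ?_
  rw [Finset.sum_add_distrib, ← Finset.mul_sum, ← Finset.mul_sum]
  have h3 := h.sum_pow_four_le
  have h4 := mul_le_mul_of_nonneg_left (sum_largeIndicator_le N)
    (by positivity : 0 ≤ (N : ℝ) ^ 2 * (2 * Real.exp K))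
  have h5 : (2 : ℝ) ^ N * (5200 / N ^ 2) = 4 * (2 ^ N * (1300 / N ^ 2)) := by ring
  rw [mul_add, h5]
  linarith

theorem sum_sq_sum_nbCount_le (h : NearCritical N K z) :
    ∑ x : Cube N, (∑ n ∈ Finset.Ico 1 (N ^ 2), z ^ n * nbCount n x) ^ 2 ≤
      640 / N + 2 * (N ^ 2 * (2 * Real.exp K)) ^ 2 * (2 * Real.exp (-N / 8)) := by
  rw [sum_sq_sum_nbCount, inv_mul_le_iff₀ (by positivity)]
  have h2 : ∀ s : Cube N, (∑ n ∈ Finset.Ico 1 (N ^ 2), z ^ n * nbFourier n s) ^ 2 ≤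
      32 * spectralRate z s ^ 2 + 2 * (N ^ 2 * (2 * Real.exp K)) ^ 2 * largeIndicator s := by
    intro s
    have h3 := (Finset.abs_sum_le_sum_abs _ _).trans (h.sum_Ico_le 1 s)
    have h4 : largeIndicator s ^ 2 = largeIndicator s := by
      unfold largeIndicator; split_ifs <;> norm_num
    rw [← sq_abs]
    refine (pow_le_pow_left₀ (abs_nonneg _) h3 2).trans ?_
    refine add_sq_le.trans (le_of_eq ?_)
    rw [mul_pow, mul_pow, h4]
    ring
  refine (Finset.sum_le_sum fun s _ => h2 s).trans ?_
  rw [Finset.sum_add_distrib, ← Finset.mul_sum, ← Finset.mul_sum]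
  have h3 := h.sum_sq_le
  have h4 := mul_le_mul_of_nonneg_left (sum_largeIndicator_le N)
    (by positivity : 0 ≤ 2 * ((N : ℝ) ^ 2 * (2 * Real.exp K)) ^ 2)
  have h5 : (2 : ℝ) ^ N * (640 / N) = 32 * (2 ^ N * (20 / N)) := by ring
  rw [mul_add, h5]
  linarith

/-- Mixing at time `N²`. A small rate decays like `(3/4)^(N²)`. At a large eigenvalue the gap gives
`((N-2)/(N-1))^(N²) ≤ exp (-N)`, which is smaller than `1 / V`. -/
theorem abs_nbFourier_sq_le (h : NearCritical N K z) {s : Cube N} (h0 : s ≠ 0) (h1 : s ≠ 1) :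
    |z ^ N ^ 2 * nbFourier (N ^ 2) s| ≤ (2 ^ N : ℝ)⁻¹ * (1 + Real.exp K) := by
  have hN := h.dim'
  have hz := h.nonneg
  have hK := Real.exp_pos K
  by_cases hs : spectralRate z s ≤ 3 / 4
  · refine (abs_pow_mul_nbFourier_le hz (by linarith [h.dim]) _ s).trans ?_
    have h2 : spectralRate z s ^ N ^ 2 ≤ ((1 / 2 : ℝ)) ^ N := by
      rw [sq, pow_mul]
      refine pow_le_pow_left₀ (pow_nonneg (spectralRate_nonneg hz s) _) ?_ _
      calc spectralRate z s ^ N ≤ (3 / 4) ^ N :=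
            pow_le_pow_left₀ (spectralRate_nonneg hz s) hs _
        _ ≤ (3 / 4) ^ 3 := pow_le_pow_of_le_one (by norm_num) (by norm_num) (by linarith [h.dim])
        _ ≤ 1 / 2 := by norm_num
    refine h2.trans ?_
    rw [one_div, inv_pow]
    exact le_mul_of_one_le_right (by positivity) (by linarith)
  · push Not at hs
    have h2 := h.half_lt_abs_eigenvalue hs
    have h3 : 4 * (N : ℝ) ≤ eigenvalue s ^ 2 := by rw [← sq_abs]; nlinarith
    rw [abs_mul, abs_of_nonneg (pow_nonneg hz _), nbFourier_eq]
    have h4 : 1 - 1 / ((N : ℝ) - 1) ≤ Real.exp (-(1 / N)) := by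
      have h6 : 1 / (N : ℝ) ≤ 1 / ((N : ℝ) - 1) :=
        one_div_le_one_div_of_le (by linarith) (by linarith)
      linarith [Real.add_one_le_exp (-(1 / (N : ℝ)))]
    have h40 : 0 ≤ 1 - 1 / ((N : ℝ) - 1) := by
      rw [sub_nonneg, div_le_one (by linarith)]; linarith
    have h5 : z ^ N ^ 2 * |nbPoly N (eigenvalue s) (N ^ 2)| ≤
        Real.exp K * (2 ^ N : ℝ)⁻¹ := by
      calc z ^ N ^ 2 * |nbPoly N (eigenvalue s) (N ^ 2)|
          ≤ z ^ N ^ 2 * (N - 2 : ℝ) ^ N ^ 2 := by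
            gcongr
            exact (abs_nbPoly_le_pow (by linarith) h3 _).trans
              (pow_le_pow_left₀ (abs_nonneg _) (abs_eigenvalue_le h0 h1) _)
        _ = (z * (N - 1)) ^ N ^ 2 * (1 - 1 / ((N : ℝ) - 1)) ^ N ^ 2 := by
            rw [← mul_pow, ← mul_pow]
            congr 1
            have : (N : ℝ) - 1 ≠ 0 := by linarith
            field_simp
            ring
        _ ≤ Real.exp K * Real.exp (-(1 / N)) ^ N ^ 2 := by
            gcongr
            exact h.pow_le le_rfl
        _ = Real.exp K * (Real.exp 1 ^ N)⁻¹ := by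
            rw [← Real.exp_nat_mul, ← Real.exp_nat_mul, ← Real.exp_neg]
            congr 2
            push_cast
            field_simp
        _ ≤ Real.exp K * (2 ^ N : ℝ)⁻¹ := by
            gcongr
            linarith [Real.add_one_le_exp 1]
    refine h5.trans ?_
    have : (0 : ℝ) < (2 ^ N : ℝ)⁻¹ := by positivity
    nlinarith

/-- In the inverse transform, the frequencies `0` and `1` contribute at most `2 * exp K` each, and
the remaining ones together at most `1 + exp K`. -/
theorem pow_mul_nbCount_le (h : NearCritical N K z) (x : Cube N) :
    z ^ N ^ 2 * nbCount (N ^ 2) x ≤ (2 ^ N : ℝ)⁻¹ * (1 + 5 * Real.exp K) := by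
  rw [nbCount_eq, mul_left_comm]
  gcongr
  rw [Finset.mul_sum]
  have key : ∀ s : Cube N, z ^ N ^ 2 * (character s x * nbFourier (N ^ 2) s) ≤
      (2 ^ N : ℝ)⁻¹ * (1 + Real.exp K) +
        ((if s = 0 then 2 * Real.exp K else 0) + if s = 1 then 2 * Real.exp K else 0) := by
    intro s
    have hK := Real.exp_pos K
    have h2 : z ^ N ^ 2 * (character s x * nbFourier (N ^ 2) s) ≤
        |z ^ N ^ 2 * nbFourier (N ^ 2) s| := by
      refine (le_abs_self _).trans (le_of_eq ?_)
      rw [mul_left_comm, abs_mul, abs_character, one_mul]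
    refine h2.trans ?_
    have h3 : 0 ≤ (2 ^ N : ℝ)⁻¹ * (1 + Real.exp K) := by positivity
    by_cases h0 : s = 0
    · rw [if_pos h0]
      have := h.abs_le_exp le_rfl s
      split_ifs <;> linarith
    · by_cases h1 : s = 1
      · rw [if_pos h1, if_neg h0]
        linarith [h.abs_le_exp le_rfl s]
      · rw [if_neg h0, if_neg h1]
        linarith [h.abs_nbFourier_sq_le h0 h1]
  refine (Finset.sum_le_sum fun s _ => key s).trans (le_of_eq ?_)
  rw [Finset.sum_add_distrib, Finset.sum_add_distrib]
  simp [ZMod.card]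
  ring

end NearCritical

/-! ### The bubble diagram and the location of the critical value -/

variable {K z : ℝ}

theorem exp_le_sqrt_two_pow (N : ℕ) : Real.exp (N / 8) ≤ √((2 : ℝ) ^ N) := by
  refine Real.le_sqrt_of_sq_le ?_
  rw [← Real.exp_nat_mul, show ((2 : ℕ) : ℝ) * (N / 8) = N * (1 / 4) by push_cast; ring,
    Real.exp_nat_mul]
  gcongr
  have h1 : Real.exp (1 / 4) ≤ Real.exp 1 ^ ((1 : ℝ) / 4) := by
    rw [← Real.exp_mul]; norm_num
  refine h1.trans ?_
  rw [← Real.exp_mul, one_mul, ← Real.le_log_iff_exp_le (by norm_num)]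
  linarith [Real.log_two_gt_d9]

/-- The exponentially small error terms are negligible in dimension `N`. -/
def NegligibleErrors (N : ℕ) (K : ℝ) : Prop :=
  16 * Real.exp K ^ 2 * (N : ℝ) ^ 5 * Real.exp (-N / 8) ≤ 1

theorem eventually_negligibleErrors (K : ℝ) :
    ∀ᶠ N : ℕ in Filter.atTop, NegligibleErrors N K := by
  have h1 : Filter.Tendsto (fun x : ℝ => x ^ 5 * Real.exp (-x)) Filter.atTop (nhds 0) :=
    Real.tendsto_pow_mul_exp_neg_atTop_nhds_zero 5
  have h2 : Filter.Tendsto (fun N : ℕ => (N : ℝ) / 8) Filter.atTop Filter.atTop :=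
    tendsto_natCast_atTop_atTop.atTop_div_const (by norm_num)
  have h3 := (h1.comp h2).const_mul (16 * Real.exp K ^ 2 * 8 ^ 5)
  rw [mul_zero] at h3
  filter_upwards [h3.eventually (ge_mem_nhds one_pos)] with N hN
  refine le_trans (le_of_eq ?_) hN
  simp only [Function.comp]
  rw [neg_div]
  ring

theorem NearCritical.twoPoint_le (h : NearCritical N K z) {x : Cube N} (hx : x ≠ 0) :
    twoPoint z x ≤ ∑ n ∈ Finset.Ico 1 (N ^ 2), z ^ n * nbCount n x +
      susceptibility N z * ((2 ^ N : ℝ)⁻¹ * (1 + 5 * Real.exp K)) := by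
  have h1 := HypercubeSAW.twoPoint_le h.nonneg (N ^ 2) x h.pow_mul_nbCount_le
  rwa [Finset.range_eq_Ico, Finset.sum_eq_sum_Ico_succ_bot (by have := h.dim; positivity),
    nbCount_zero hx, mul_zero, zero_add, zero_add] at h1

/-- The one-step term gives `z`, with coefficient exactly `1`. Lengths 2 and 3 are counted by hand
as `2z²` and `2Nz³`, both `O(N⁻²)`; from length 4 on, the fourth moment gives `5200 / N²`. The two
exponentially small errors cost at most `1 / N²` each. -/
theorem NearCritical.twoPoint_le_add (h : NearCritical N K z) (he : NegligibleErrors N K)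
    (hχ : susceptibility N z ≤ √((2 : ℝ) ^ N)) {x : Cube N} (hx : x ≠ 0) :
    twoPoint z x ≤ z + 5210 / N ^ 2 := by
  have hN := h.dim'
  have hz := h.nonneg
  have hK := Real.one_le_exp h.pos
  have hV : 0 < √((2 : ℝ) ^ N) := by positivity
  have h1 := h.twoPoint_le hx
  have hT : 4 < N ^ 2 := by nlinarith [h.dim]
  rw [Finset.sum_eq_sum_Ico_succ_bot (by omega), Finset.sum_eq_sum_Ico_succ_bot (by omega),
    Finset.sum_eq_sum_Ico_succ_bot (by omega)] at h1
  norm_num only at h1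
  have e1 : z ^ 1 * nbCount 1 x ≤ z := by
    rw [pow_one]; exact mul_le_of_le_one_right hz (nbCount_one_le x)
  have hz1 : z ≤ 5 / 4 / N := by
    rw [le_div_iff₀ (by linarith)]; exact h.mul_le
  have e2 : z ^ 2 * nbCount 2 x ≤ 25 / 8 / (N : ℝ) ^ 2 := by
    calc z ^ 2 * nbCount 2 x ≤ (5 / 4 / (N : ℝ)) ^ 2 * 2 := by
          gcongr
          · exact nbCount_nonneg _ _
          · exact nbCount_two_le x
      _ = 25 / 8 / (N : ℝ) ^ 2 := by ring
  have e3 : z ^ 3 * nbCount 3 x ≤ 125 / 32 / (N : ℝ) ^ 2 := by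
    calc z ^ 3 * nbCount 3 x ≤ (5 / 4 / (N : ℝ)) ^ 3 * (N * 2) := by
          gcongr
          · exact nbCount_nonneg _ _
          · exact nbCount_succ_le 2 nbCount_two_le x
      _ = 125 / 32 / (N : ℝ) ^ 2 := by field_simp; norm_num
  have e4 := h.sum_pow_mul_nbCount_le x
  have hE := Real.exp_pos (-N / 8 : ℝ)
  have hN5 : (N : ℝ) ^ 4 ≤ N ^ 5 := pow_le_pow_right₀ (by linarith) (by norm_num)
  have hK2 : Real.exp K ≤ Real.exp K ^ 2 := le_self_pow₀ hK (by norm_num)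
  have e5 : (N : ℝ) ^ 2 * (2 * Real.exp K) * (2 * Real.exp (-N / 8)) ≤ 1 / N ^ 2 := by
    rw [le_div_iff₀ (by positivity)]
    refine le_trans ?_ he
    calc (N : ℝ) ^ 2 * (2 * Real.exp K) * (2 * Real.exp (-N / 8)) * N ^ 2
        = 4 * Real.exp K * N ^ 4 * Real.exp (-N / 8) := by ring
      _ ≤ 16 * Real.exp K ^ 2 * N ^ 5 * Real.exp (-N / 8) := by gcongr; norm_num
  have e6 : susceptibility N z * ((2 ^ N : ℝ)⁻¹ * (1 + 5 * Real.exp K)) ≤ 1 / N ^ 2 := by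
    rw [le_div_iff₀ (by positivity)]
    refine le_trans ?_ he
    have hV2 : √((2 : ℝ) ^ N) * (2 ^ N : ℝ)⁻¹ ≤ Real.exp (-N / 8) := by
      nth_rw 2 [← Real.mul_self_sqrt (by positivity : (0 : ℝ) ≤ 2 ^ N)]
      rw [mul_inv, mul_inv_cancel_left₀ hV.ne', neg_div, Real.exp_neg]
      exact inv_anti₀ (Real.exp_pos _) (exp_le_sqrt_two_pow N)
    have hN2 : (N : ℝ) ^ 2 ≤ N ^ 5 := pow_le_pow_right₀ (by linarith) (by norm_num)
    calc susceptibility N z * ((2 ^ N : ℝ)⁻¹ * (1 + 5 * Real.exp K)) * N ^ 2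
        ≤ √((2 : ℝ) ^ N) * ((2 ^ N : ℝ)⁻¹ * (1 + 5 * Real.exp K)) * N ^ 2 := by gcongr
      _ = (1 + 5 * Real.exp K) * N ^ 2 * (√((2 : ℝ) ^ N) * (2 ^ N : ℝ)⁻¹) := by ring
      _ ≤ (16 * Real.exp K ^ 2) * N ^ 5 * Real.exp (-N / 8) := by
          gcongr
          linarith
  have hsum : z + 25 / 8 / N ^ 2 + 125 / 32 / N ^ 2 + 5200 / N ^ 2 + 1 / N ^ 2 + 1 / N ^ 2 ≤
      z + 5210 / (N : ℝ) ^ 2 := by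
    have : (0 : ℝ) < 1 / N ^ 2 := by positivity
    linear_combination (5210 - 5202 - 25 / 8 - 125 / 32) * this.le
  linarith

/-- The bubble diagram without its trivial term is small. -/
theorem NearCritical.sum_twoPoint_sq_le (h : NearCritical N K z) (he : NegligibleErrors N K)
    {lam : ℝ} (hχ : susceptibility N z ≤ lam * √((2 : ℝ) ^ N)) :
    ∑ x : Cube N with x ≠ 0, twoPoint z x ^ 2 ≤
      1282 / N + 2 * (1 + 5 * Real.exp K) ^ 2 * lam ^ 2 := by
  have hN := h.dim'
  have hz := h.nonneg
  have hχ0 : 0 ≤ susceptibility N z := zero_le_one.trans (one_le_susceptibility hz)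
  set τ := susceptibility N z * ((2 ^ N : ℝ)⁻¹ * (1 + 5 * Real.exp K)) with hτ
  have h1 : ∑ x : Cube N with x ≠ 0, twoPoint z x ^ 2 ≤
      ∑ x : Cube N, (2 * (∑ n ∈ Finset.Ico 1 (N ^ 2), z ^ n * nbCount n x) ^ 2 + 2 * τ ^ 2) := by
    refine (Finset.sum_le_sum fun x hx => ?_).trans
      (Finset.sum_le_sum_of_subset_of_nonneg (Finset.filter_subset _ _)
        fun _ _ _ => by positivity)
    rw [← mul_add]
    exact (pow_le_pow_left₀ (twoPoint_nonneg hz x)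
      (h.twoPoint_le (Finset.mem_filter.1 hx).2) 2).trans add_sq_le
  rw [Finset.sum_add_distrib, ← Finset.mul_sum] at h1
  have h2 := h.sum_sq_sum_nbCount_le
  -- This error dictates the constant and the powers in `NegligibleErrors`.
  have h3 : 2 * ((N : ℝ) ^ 2 * (2 * Real.exp K)) ^ 2 * (2 * Real.exp (-N / 8)) ≤ 1 / N := by
    rw [le_div_iff₀ (by positivity)]
    refine le_trans (le_of_eq ?_) he
    ring
  have h4 : ∑ _x : Cube N, 2 * τ ^ 2 ≤ 2 * (1 + 5 * Real.exp K) ^ 2 * lam ^ 2 := by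
    have hc : ∑ _x : Cube N, 2 * τ ^ 2 = 2 ^ N * (2 * τ ^ 2) := by simp [ZMod.card]
    have hs := pow_le_pow_left₀ hχ0 hχ 2
    rw [mul_pow, Real.sq_sqrt (by positivity)] at hs
    rw [hc, hτ]
    calc 2 ^ N * (2 * (susceptibility N z * ((2 ^ N : ℝ)⁻¹ * (1 + 5 * Real.exp K))) ^ 2)
        = 2 * (1 + 5 * Real.exp K) ^ 2 * ((2 ^ N : ℝ)⁻¹ * susceptibility N z ^ 2) := by
          field_simp
      _ ≤ 2 * (1 + 5 * Real.exp K) ^ 2 * ((2 ^ N : ℝ)⁻¹ * (lam ^ 2 * 2 ^ N)) := by gcongr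
      _ = _ := by field_simp
  have h5 : (1282 : ℝ) / N = 2 * (640 / N + 1 / N) := by ring
  rw [h5]
  linarith

/-- As long as the susceptibility is at most `V ^ (1/2)`, `z` is at most slightly above
`1 / (N - 1)`. -/
theorem nearCritical_of_susceptibility_le (hK : 10430 ≤ K) (hN : K ≤ N)
    (he : NegligibleErrors N K) (hz : 0 ≤ z) (hχ : susceptibility N z ≤ √((2 : ℝ) ^ N)) :
    NearCritical N K z := by
  have hN' : (10430 : ℝ) ≤ N := hK.trans hN
  have hN1 : 100 ≤ N := by
    have : (100 : ℝ) ≤ N := by linarith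
    exact_mod_cast this
  have hsmall : 10 * K ≤ (N : ℝ) ^ 2 := by nlinarith
  by_contra hnot
  have hlt : 1 + K / (N : ℝ) ^ 2 < z * (N - 1) := by
    by_contra! hle
    exact hnot ⟨hz, hN1, by linarith, hsmall, hle⟩
  set κ := K / (N : ℝ) ^ 2 with hκ
  have hκ0 : 0 ≤ κ := by positivity
  -- The largest value at which `NearCritical` holds. No continuity argument is needed: `χ` is
  -- monotone, so its bound at `z` passes to `y`.
  set y := (1 + κ) / ((N : ℝ) - 1) with hy
  have hN0 : (0 : ℝ) < N - 1 := by linarith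
  have hy0 : 0 < y := by positivity
  have hyz : y ≤ z := by
    rw [hy, div_le_iff₀ hN0]; exact hlt.le
  have hyN : y * (N - 1) = 1 + κ := div_mul_cancel₀ _ hN0.ne'
  have h : NearCritical N K y := ⟨hy0.le, hN1, by linarith, hsmall, hyN.le⟩
  have hχy : susceptibility N y ≤ √((2 : ℝ) ^ N) :=
    ((susceptibility_strictMonoOn (by omega)).monotoneOn (Set.mem_Ici.2 hy0.le)
      (Set.mem_Ici.2 hz) hyz).trans hχ
  have h1 := mul_susceptibility_le (N := N) hy0.le
  have hχ0 : 0 < susceptibility N y := zero_lt_one.trans_le (one_le_susceptibility hy0.le)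
  have h2 : ∑ d : Fin N, twoPoint y (Pi.single d 1) * susceptibility N y ≤
      N * (y + 5210 / N ^ 2) * susceptibility N y := by
    rw [← Finset.sum_mul]
    gcongr
    have h3 : ∀ d : Fin N, twoPoint y (Pi.single d 1) ≤ y + 5210 / N ^ 2 := fun d =>
      h.twoPoint_le_add he hχy (by simp)
    refine (Finset.sum_le_sum fun d _ => h3 d).trans (le_of_eq ?_)
    simp
    ring
  -- With the bound on `G(e_d)`, this contradicts the first-step inequality, whose `-1` makes it
  -- strict.
  have h4 : 1 ≤ y * N * (1 - y - 5210 / N ^ 2) := by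
    have hκN : κ * N ^ 2 = K := by rw [hκ]; field_simp
    have hκ1 : κ * N ≤ 1 := by nlinarith
    have hκ2 : κ ≤ 1 / 100 := by nlinarith
    -- The terms of order `N²` and `N` cancel. What remains is `κ * N² = K` against `5210` plus
    -- small corrections, and `K ≥ 10430` leaves ample room.
    have hA : ((N : ℝ) - 1) ^ 2 ≤ (1 + κ) * (N * (N - 1) - N * (1 + κ) - 5210) := by
      nlinarith
    have hB : y * N * (1 - y - 5210 / N ^ 2) * (N - 1) ^ 2 =
        (1 + κ) * (N * (N - 1) - N * (1 + κ) - 5210 * ((N - 1) / N)) := by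
      rw [hy]; field_simp
    have hC : ((N : ℝ) - 1) / N ≤ 1 := by rw [div_le_one (by linarith)]; linarith
    have hD : (1 + κ) * (N * (N - 1) - N * (1 + κ) - 5210) ≤
        (1 + κ) * (N * (N - 1) - N * (1 + κ) - 5210 * (((N : ℝ) - 1) / N)) := by
      gcongr; linarith
    have hsq : (0 : ℝ) < (N - 1) ^ 2 := by positivity
    refine le_of_mul_le_mul_right ?_ hsq
    linarith
  have h5 : y * ∑ d : Fin N, twoPoint y (Pi.single d 1) * susceptibility N y ≤
      y * (N * (y + 5210 / N ^ 2) * susceptibility N y) := by gcongr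
  nlinarith

end HypercubeSAW

/-! ### Conclusion -/

theorem theorem1p5 :
    ∃ lam0 : ℝ, 0 < lam0 ∧ ∃ C : ℝ, 0 < C ∧
      ∀ lam : ℝ, 0 < lam → lam ≤ lam0 →
      ∀ N : ℕ, 1 ≤ N → 1 ≤ lam * √((2 : ℝ) ^ N) →
        (∀ z : ℝ, 0 ≤ z → z ≤ HypercubeSAW.criticalValue N lam →
          (1 - C * (1 / (N : ℝ) + lam ^ 2)) * HypercubeSAW.susceptibility N z
              ≤ HypercubeSAW.expectedLength N z ∧
            HypercubeSAW.expectedLength N z ≤ HypercubeSAW.susceptibility N z) ∧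
        |HypercubeSAW.expectedLength N (HypercubeSAW.criticalValue N lam)
            - lam * √((2 : ℝ) ^ N)|
          ≤ C * (1 / (N : ℝ) + lam ^ 2) * (lam * √((2 : ℝ) ^ N)) := by
  open HypercubeSAW in
  obtain ⟨N₀, hN₀⟩ := Filter.eventually_atTop.1 ((eventually_negligibleErrors 10430).and
    (Filter.eventually_ge_atTop 10430))
  -- `N₀` makes the lower bound trivial in dimensions below it; the other two terms are the
  -- coefficients in the bubble estimate.
  set C : ℝ := N₀ + 1282 + 2 * (1 + 5 * Real.exp 10430) ^ 2 with hC
  have hE := Real.exp_pos 10430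
  refine ⟨1, one_pos, C, by positivity, fun lam hlam0 hlam1 N hN hlamN => ?_⟩
  have hNpos : (0 : ℝ) < N := by exact_mod_cast hN
  have main : ∀ z : ℝ, 0 ≤ z → z ≤ criticalValue N lam →
      (1 - C * (1 / (N : ℝ) + lam ^ 2)) * susceptibility N z ≤ expectedLength N z ∧
        expectedLength N z ≤ susceptibility N z := by
    intro z hz hzc
    obtain ⟨hc0, hc⟩ := criticalValue_spec hN hlamN
    have hχ : susceptibility N z ≤ lam * √((2 : ℝ) ^ N) := by
      rw [← hc]
      exact (susceptibility_strictMonoOn hN).monotoneOn (Set.mem_Ici.2 hz)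
        (Set.mem_Ici.2 hc0) hzc
    have hχ0 : 0 < susceptibility N z := zero_lt_one.trans_le (one_le_susceptibility hz)
    rw [expectedLength_eq_sum]
    constructor
    · rw [le_div_iff₀ hχ0]
      by_cases hNN : N₀ ≤ N
      · obtain ⟨he, hK⟩ := hN₀ N hNN
        have hnc : NearCritical N 10430 z := by
          refine nearCritical_of_susceptibility_le le_rfl (by exact_mod_cast hK) he hz ?_
          exact hχ.trans (mul_le_of_le_one_left (by positivity) hlam1)
        refine le_trans ?_ (susceptibility_sq_le hz)
        have hB := hnc.sum_twoPoint_sq_le he hχ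
        have hB2 : 1282 / N + 2 * (1 + 5 * Real.exp 10430) ^ 2 * lam ^ 2 ≤
            C * (1 / (N : ℝ) + lam ^ 2) := by
          have e1 : 1282 / (N : ℝ) ≤ C * (1 / N) := by
            rw [div_eq_mul_one_div]
            gcongr
            have : 0 ≤ 2 * (1 + 5 * Real.exp 10430) ^ 2 := by positivity
            linarith [Nat.cast_nonneg (α := ℝ) N₀]
          have e2 : 2 * (1 + 5 * Real.exp 10430) ^ 2 * lam ^ 2 ≤ C * lam ^ 2 := by
            gcongr
            linarith [Nat.cast_nonneg (α := ℝ) N₀]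
          linarith
        rw [mul_assoc, ← sq, mul_comm]
        gcongr
        linarith
      · push Not at hNN
        -- Here `N < N₀ ≤ C`, so the prefactor in the lower bound is nonpositive.
        have h1 : 1 ≤ C * (1 / (N : ℝ) + lam ^ 2) := by
          have hNC : (N : ℝ) ≤ C := by
            have : (N : ℝ) ≤ N₀ := by exact_mod_cast hNN.le
            have : 0 ≤ 2 * (1 + 5 * Real.exp 10430) ^ 2 := by positivity
            linarith
          calc (1 : ℝ) = N * (1 / N) := by field_simp
            _ ≤ C * (1 / (N : ℝ) + lam ^ 2) := by
              gcongr
              linarith [sq_nonneg lam]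
        refine le_trans (b := 0) ?_ (Finset.sum_nonneg fun w _ => by positivity)
        rw [mul_assoc]
        exact mul_nonpos_of_nonpos_of_nonneg (by linarith) (by positivity)
    · rw [div_le_iff₀ hχ0, ← sq]
      exact sum_length_le_susceptibility_sq hz
  refine ⟨main, ?_⟩
  obtain ⟨hc0, hc⟩ := criticalValue_spec hN hlamN
  obtain ⟨h1, h2⟩ := main _ hc0 le_rfl
  rw [hc] at h1 h2
  rw [abs_le]
  have h3 : 0 ≤ C * (1 / (N : ℝ) + lam ^ 2) * (lam * √((2 : ℝ) ^ N)) := by positivity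
  constructor <;> linarith
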